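/- Let $0<p<1$, let $A\in\mathbb{C}^{n\times n}$ have a Jordan form $A=P\,\mathrm{diag}(J_1,\dots,J_l)\,P^{-1}$, where $J_j$ is the $n_j\times n_j$ Jordan block with eigenvalue $\lambda_j$, and assume that $\lambda_j\neq 0$ and $|\arg\lambda_j|\neq p\pi/2$ for all $j$. Call $J_j$ unstable if $|\arg\lambda_j|<p\pi/2$. For a square matrix $M$ put $E_{p,\beta}(M)=\sum_{k\ge 0}M^k/\Gamma(pk+\beta)$ and $E_p=E_{p,1}$. With the principal branch of $\lambda^{1/p}$, put $$\Psi_m(t,\lambda)=\frac1{m!}\frac{\partial^m}{\partial\lambda^m}\Big(\frac1p e^{t\lambda^{1/p}}\Big),\qquad \widetilde\Psi_m(t,\lambda)=\frac1{m!}\frac{\partial^{m+1}}{\partial\lambda^{m+1}}e^{t\lambda^{1/p}} .$$ For an unstable block let $B_j(t)$ and $\widetilde{B_j}(t)$ be the $n_j\times n_j$ upper triangular Toeplitz matrices with first rows $(\Psi_m(t,\lambda_j))_{0\le m<n_j}$ and $(\widetilde\Psi_m(t,\lambda_j))_{0\le m<n_j}$, and let $\Pi_j=I$; for all other blocks let $B_j=\widetilde{B_j}=\Pi_j=0$.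 Put $B(t)=P\,\mathrm{diag}(B_j(t))P^{-1}$, $\widetilde B(t)=P\,\mathrm{diag}(\widetilde{B_j}(t))P^{-1}$, $\pi_u=P\,\mathrm{diag}(\Pi_j)P^{-1}$ (the projection onto the unstable subspace), and $C(t)=E_p(t^pA)-B(t)$. For every $N>0$ there are constants $K_3$ and $K_5$, depending only on $N$, $p$, $A$ and the chosen Jordan form, such that for all $t>N$ and all bounded continuous $g:[0,\infty)\to\mathbb{C}^n$, with $\|g\|_\infty=\sup_{\tau\ge0}\|g(\tau)\|$ and the Euclidean norm on $\mathbb{C}^n$, all integrals below converge absolutely and 1. $\displaystyle\Big\|\int_0^\infty \frac p\tau\, C(t)\widetilde B(-\tau)\,\pi_u g(\tau)\,d\tau\Big\|\le K_3\,\|g\|_\infty$; 2. $\displaystyle\Big\|\int_0^t (t-\tau)^{p-1}E_{p,p}\big((t-\tau)^pA\big)\,\pi_u g(\tau)\,d\tau+\int_0^\infty\frac p\tau\, B(t)\widetilde B(-\tau)\,\pi_u g(\tau)\,d\tau\Big\|\le K_5\,\|g\|_\infty$, with strict inequality if $g\neq0$. -/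

import Mathlib

namespace FracSys

/-- The two-parameter Mittag-Leffler function
`E_{p,β}(M) = ∑ k, M ^ k / Γ(p k + β)` of a square complex matrix. -/
noncomputable def mittagLeffler {n : ℕ} (p β : ℝ) (M : Matrix (Fin n) (Fin n) ℂ) :
    Matrix (Fin n) (Fin n) ℂ :=
  ∑' k : ℕ, (((Real.Gamma (p * k + β))⁻¹ : ℝ) : ℂ) • M ^ k

/-- The `m × m` Jordan block with eigenvalue `lam` (ones on the superdiagonal). -/
def jordanBlock (m : ℕ) (lam : ℂ) : Matrix (Fin m) (Fin m) ℂ :=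
  Matrix.of fun i k => if i = k then lam else if (i : ℕ) + 1 = (k : ℕ) then 1 else 0

/-- The upper triangular Toeplitz matrix with first row `c 0, c 1, …, c (m - 1)`. -/
def upperToeplitz (m : ℕ) (c : ℕ → ℂ) : Matrix (Fin m) (Fin m) ℂ :=
  Matrix.of fun i k => if (i : ℕ) ≤ (k : ℕ) then c ((k : ℕ) - (i : ℕ)) else 0

/-- A Jordan canonical form `A = P * diag(J_1, …, J_l) * P⁻¹` of a square matrix. -/
structure JordanForm {n : ℕ} (A : Matrix (Fin n) (Fin n) ℂ) where
  /-- the number of blocks -/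
  l : ℕ
  /-- the sizes of the blocks -/
  size : Fin l → ℕ
  size_pos : ∀ j, 0 < size j
  /-- the eigenvalues of the blocks -/
  eig : Fin l → ℂ
  /-- the change of basis -/
  P : Matrix (Fin n) (Σ j : Fin l, Fin (size j)) ℂ
  /-- the inverse of the change of basis -/
  Pinv : Matrix (Σ j : Fin l, Fin (size j)) (Fin n) ℂ
  P_mul_Pinv : P * Pinv = 1
  Pinv_mul_P : Pinv * P = 1
  eq_conj : A = P * Matrix.blockDiagonal' (fun j => jordanBlock (size j) (eig j)) * Pinv

/-- `Ψ_m(t, lam) = (1/m!) ∂^m/∂lam^m ((1/p) exp (t lam^(1/p)))`, principal branch. -/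
noncomputable def psi (p : ℝ) (m : ℕ) (t : ℝ) (lam : ℂ) : ℂ :=
  1 / (m.factorial : ℂ) *
    iteratedDeriv m (fun z : ℂ => 1 / (p : ℂ) * Complex.exp ((t : ℂ) * z ^ (1 / (p : ℂ)))) lam

/-- `Ψ̃_m(t, lam) = (1/m!) ∂^(m+1)/∂lam^(m+1) exp (t lam^(1/p))`, principal branch. -/
noncomputable def psiTilde (p : ℝ) (m : ℕ) (t : ℝ) (lam : ℂ) : ℂ :=
  1 / (m.factorial : ℂ) *
    iteratedDeriv (m + 1) (fun z : ℂ => Complex.exp ((t : ℂ) * z ^ (1 / (p : ℂ)))) lam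

/-- An eigenvalue is unstable for the order `p` if `|arg lam| < p π / 2`. -/
def IsUnstable (p : ℝ) (lam : ℂ) : Prop :=
  |Complex.arg lam| < p * Real.pi / 2

namespace JordanForm

variable {n : ℕ} {A : Matrix (Fin n) (Fin n) ℂ}

/-- No eigenvalue is zero or lies on one of the critical rays `|arg lam| = p π / 2`. -/
def IsHyperbolic (J : JordanForm A) (p : ℝ) : Prop :=
  ∀ j, J.eig j ≠ 0 ∧ |Complex.arg (J.eig j)| ≠ p * Real.pi / 2

open Classical in
/-- The matrix, in the original basis, that acts as `D j` on the `j`-th Jordan block if the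
block is unstable, and as `0` if it is not. -/
noncomputable def unstableDiag (J : JordanForm A) (p : ℝ)
    (D : ∀ j, Matrix (Fin (J.size j)) (Fin (J.size j)) ℂ) : Matrix (Fin n) (Fin n) ℂ :=
  J.P * Matrix.blockDiagonal' (fun j => if IsUnstable p (J.eig j) then D j else 0) * J.Pinv

/-- The projection `π_u` onto the unstable subspace, along the stable one. -/
noncomputable def piU (J : JordanForm A) (p : ℝ) : Matrix (Fin n) (Fin n) ℂ :=
  J.unstableDiag p fun _ => 1

/-- `B(t)`. -/
noncomputable def B (J : JordanForm A) (p t : ℝ) : Matrix (Fin n) (Fin n) ℂ :=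
  J.unstableDiag p fun j => upperToeplitz (J.size j) fun m => psi p m t (J.eig j)

/-- `B̃(t)`. -/
noncomputable def Btilde (J : JordanForm A) (p t : ℝ) : Matrix (Fin n) (Fin n) ℂ :=
  J.unstableDiag p fun j => upperToeplitz (J.size j) fun m => psiTilde p m t (J.eig j)

/-- `C(t)`, the (exact) remainder in the decomposition `E_p(t^p A) = B(t) + C(t)`. -/
noncomputable def C (J : JordanForm A) (p t : ℝ) : Matrix (Fin n) (Fin n) ℂ :=
  mittagLeffler p 1 (((t ^ p : ℝ) : ℂ) • A) - J.B p t

end JordanForm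

/-- The integrand `(p / τ) C(t) B̃(-τ) π_u v`. -/
noncomputable def integrandC {n : ℕ} {A : Matrix (Fin n) (Fin n) ℂ} (J : JordanForm A)
    (p t τ : ℝ) (v : EuclideanSpace ℂ (Fin n)) : EuclideanSpace ℂ (Fin n) :=
  (p / τ) • Matrix.toEuclideanLin (J.C p t * J.Btilde p (-τ) * J.piU p) v

/-- The integrand `(p / τ) B(t) B̃(-τ) π_u v`. -/
noncomputable def integrandB {n : ℕ} {A : Matrix (Fin n) (Fin n) ℂ} (J : JordanForm A)
    (p t τ : ℝ) (v : EuclideanSpace ℂ (Fin n)) : EuclideanSpace ℂ (Fin n) :=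
  (p / τ) • Matrix.toEuclideanLin (J.B p t * J.Btilde p (-τ) * J.piU p) v

/-- The integrand `(t - τ)^(p-1) E_{p,p}((t - τ)^p A) π_u v`. -/
noncomputable def integrandE {n : ℕ} {A : Matrix (Fin n) (Fin n) ℂ} (J : JordanForm A)
    (p t τ : ℝ) (v : EuclideanSpace ℂ (Fin n)) : EuclideanSpace ℂ (Fin n) :=
  ((t - τ) ^ (p - 1)) •
    Matrix.toEuclideanLin (mittagLeffler p p ((((t - τ) ^ p : ℝ) : ℂ) • A) * J.piU p) v

end FracSys

/-! Restricted to the unstable subspace, every matrix in sight is a holomorphic function of `A`: on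
a Jordan block with eigenvalue `lam`, `F(A)` is the Toeplitz matrix of Taylor coefficients of `F` at
`lam`. The problem thus reduces to scalar kernels. Put `ω = lam ^ (1/p)` and `k(u) = ω / (p lam) *
exp(u ω)` (`expKernel`). The chain rule gives `(p/τ) B̃(-τ) = -p k(-τ)`, so `(p/τ) B(t) B̃(-τ) =
-k(t-τ)`, while `s^(p-1) E_{p,p}(s^p lam) = k(s) + r(s)` with a remainder `r` (`remKernel`). On
`(0,t)` the exponential parts cancel, and the sum in part 2 equals `∫_0^t r(t-τ) g - ∫_t^∞ k(t-τ)
g`.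

Since `Re ω > 0`, `k(-s)` decays exponentially. It remains to see that `r` is integrable on `(0,∞)`.
Near `0` it is `O(s^(p-1))`. For large `s`, `exists_norm_remKernel_le` gives `O(s^(-1-p))`: `s^2
r(s)` is the inverse Laplace transform of the second derivative of `1/(σ^p - lam)` with its only
pole in the right half plane removed, so the line of integration may be moved to `Re σ = 1/s`. Two
derivatives make all line integrals absolutely convergent.

Integrability of `r` also bounds `C(t)` on the unstable part, because `E_p(t^p lam) - (1/p) exp(t ω)
= 1 - 1/p + lam ∫_0^t r`; this gives part 1. All scalar bounds hold uniformly for `lam` in a small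
disc, so Cauchy's estimates carry them over to the Taylor coefficients, hence to the matrices. -/

namespace FracSys

open MeasureTheory Set Filter Topology

/-! ### Laplace transforms of powers and their inversion on vertical lines. -/

section LaplaceInversion

/-- The Laplace transform of a power, at a complex point of the right half plane. -/
lemma integral_rpow_mul_cexp_neg_mul_Ioi {a : ℝ} (ha : 0 < a) {z : ℂ} (hz : 0 < z.re) :
    IntegrableOn (fun x : ℝ => ((x ^ (a - 1) : ℝ) : ℂ) * Complex.exp (-(z * x))) (Ioi 0) ∧
    ∫ x in Ioi (0 : ℝ), ((x ^ (a - 1) : ℝ) : ℂ) * Complex.exp (-(z * x)) =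
      z ^ (-(a : ℂ)) * (Real.Gamma a : ℂ) := by
  have hint : ∀ z : ℂ, 0 < z.re →
      IntegrableOn (fun x : ℝ => ((x ^ (a - 1) : ℝ) : ℂ) * Complex.exp (-(z * x))) (Ioi 0) := by
    intro z hz
    have h := integrableOn_rpow_mul_exp_neg_mul_rpow (p := 1) (s := a - 1) (b := z.re)
      (by linarith) one_pos hz
    refine Integrable.mono' h ?_ ?_
    · refine Measurable.aestronglyMeasurable ?_
      fun_prop
    · refine (ae_restrict_iff' measurableSet_Ioi).2 (ae_of_all _ fun x (hx : 0 < x) => ?_)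
      rw [norm_mul, Complex.norm_exp, Complex.norm_real, Real.norm_of_nonneg (by positivity)]
      simp
  refine ⟨hint z hz, ?_⟩
  -- The integral is the complex moment generating function of this measure at `-z`, hence analytic
  -- in `z`; the identity theorem extends the formula from real `z`.
  set μ : Measure ℝ := (volume.restrict (Ioi (0 : ℝ))).withDensity
    (fun x => ENNReal.ofReal (x ^ (a - 1))) with hμ
  have hval : ∀ w : ℂ, ProbabilityTheory.complexMGF id μ w =
      ∫ x in Ioi (0 : ℝ), ((x ^ (a - 1) : ℝ) : ℂ) * Complex.exp (w * x) := by
    intro w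
    rw [ProbabilityTheory.complexMGF, hμ, integral_withDensity_eq_integral_toReal_smul
      (by fun_prop) (ae_of_all _ fun x => ENNReal.ofReal_lt_top)]
    refine setIntegral_congr_fun measurableSet_Ioi fun x (hx : 0 < x) => ?_
    simp only [id]
    rw [ENNReal.toReal_ofReal (by positivity), Complex.real_smul]
  have hset : Iio (0 : ℝ) ⊆ interior (ProbabilityTheory.integrableExpSet id μ) := by
    refine interior_maximal (fun t (ht : t < 0) => ?_) isOpen_Iio
    have h := integrableOn_rpow_mul_exp_neg_mul_rpow (p := 1) (s := a - 1) (b := -t)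
      (by linarith) one_pos (by linarith)
    show Integrable _ _
    rw [hμ, integrable_withDensity_iff_integrable_smul' (by fun_prop)
      (ae_of_all _ fun x => ENNReal.ofReal_lt_top)]
    refine h.congr ((ae_restrict_iff' measurableSet_Ioi).2 (ae_of_all _ fun x (hx : 0 < x) => ?_))
    simp only [id, neg_neg, Real.rpow_one, smul_eq_mul]
    rw [ENNReal.toReal_ofReal (by positivity)]
  set U : Set ℂ := {w | w.re < 0} with hU
  have hUo : IsOpen U := isOpen_lt Complex.continuous_re continuous_const
  have hf : AnalyticOnNhd ℂ (ProbabilityTheory.complexMGF id μ) U := fun w hw =>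
    ProbabilityTheory.analyticOnNhd_complexMGF w (hset hw)
  have hg : AnalyticOnNhd ℂ (fun w : ℂ => (-w) ^ (-(a : ℂ)) * (Real.Gamma a : ℂ)) U := by
    refine DifferentiableOn.analyticOnNhd (fun w hw => ?_) hUo
    refine DifferentiableAt.differentiableWithinAt ?_
    refine ((differentiableAt_id.neg).cpow_const (Or.inl ?_)).mul_const _
    have hw' : w.re < 0 := hw
    simpa using hw'
  have hpre : IsPreconnected U := (convex_halfSpace_re_lt 0).isPreconnected
  have h1 : (-1 : ℂ) ∈ U := by simp [hU]
  have hfreq : ∃ᶠ w in 𝓝[≠] (-1 : ℂ), ProbabilityTheory.complexMGF id μ w =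
      (-w) ^ (-(a : ℂ)) * (Real.Gamma a : ℂ) := by
    have htend : Tendsto (fun x : ℝ => (-(x : ℂ))) (𝓝[≠] 1) (𝓝[≠] (-1 : ℂ)) := by
      refine tendsto_nhdsWithin_of_tendsto_nhds_of_eventually_within _ ?_ ?_
      · have : Continuous fun x : ℝ => (-(x : ℂ)) := by fun_prop
        have := (this.tendsto 1).mono_left (nhdsWithin_le_nhds (s := {(1:ℝ)}ᶜ))
        simpa using this
      · filter_upwards [self_mem_nhdsWithin] with x hx
        simp only [mem_compl_iff, mem_singleton_iff, neg_inj] at hx ⊢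
        exact_mod_cast hx
    refine htend.frequently (Eventually.frequently ?_)
    have : ∀ᶠ x : ℝ in 𝓝[≠] 1, 0 < x := nhdsWithin_le_nhds (lt_mem_nhds one_pos)
    filter_upwards [this] with x hx
    rw [hval, neg_neg]
    have := Real.integral_rpow_mul_exp_neg_mul_Ioi ha hx
    calc ∫ y in Ioi (0 : ℝ), ((y ^ (a - 1) : ℝ) : ℂ) * Complex.exp (-(x : ℂ) * y)
        = ((∫ y in Ioi (0 : ℝ), y ^ (a - 1) * Real.exp (-(x * y)) : ℝ) : ℂ) := by
          rw [← integral_complex_ofReal]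
          congr 1; ext y; push_cast; rw [neg_mul]
      _ = _ := by
          rw [this, one_div, Real.inv_rpow hx.le, ← Real.rpow_neg hx.le, Complex.ofReal_mul,
            Complex.ofReal_cpow hx.le, Complex.ofReal_neg]
  have := hf.eqOn_of_preconnected_of_frequently_eq hg hpre h1 hfreq (x := -z) (by simpa [hU] using hz)
  rw [hval] at this
  simpa using this

/-- Powers of the distance to the origin are integrable on vertical lines. -/
lemma integrable_norm_line_rpow {a : ℝ} (ha : 1 < a) :
    ∃ K : ℝ, 0 ≤ K ∧ ∀ ε : ℝ, 0 < ε →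
      Integrable (fun y : ℝ => ‖(ε : ℂ) + y * Complex.I‖ ^ (-a)) ∧
      ∫ y : ℝ, ‖(ε : ℂ) + y * Complex.I‖ ^ (-a) = K * ε ^ (1 - a) := by
  have h1 : Integrable (fun y : ℝ => ‖(1 : ℂ) + y * Complex.I‖ ^ (-a)) := by
    have := integrable_rpow_neg_one_add_norm_sq (E := ℝ) (μ := volume) (r := a) (by simpa using ha)
    refine this.congr (ae_of_all _ fun y => ?_)
    have h2 : ‖(1 : ℂ) + y * Complex.I‖ = (1 + ‖y‖ ^ 2) ^ (1 / 2 : ℝ) := by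
      rw [← Real.sqrt_eq_rpow]
      have := Complex.norm_add_mul_I 1 y
      simp only [Complex.ofReal_one] at this
      rw [this]; simp
    simp only [h2]
    rw [← Real.rpow_mul (by positivity)]
    congr 1; ring
  refine ⟨∫ y : ℝ, ‖(1 : ℂ) + y * Complex.I‖ ^ (-a), integral_nonneg fun y => by positivity, ?_⟩
  intro ε hε
  -- Scaling `y = ε u` reduces every line to the line `Re = 1`.
  have key : (fun y : ℝ => ‖(ε : ℂ) + y * Complex.I‖ ^ (-a)) =
      fun y => ε ^ (-a) * ‖(1 : ℂ) + ((ε⁻¹ * y : ℝ) : ℂ) * Complex.I‖ ^ (-a) := by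
    ext y
    rw [← Real.mul_rpow hε.le (norm_nonneg _)]
    congr 1
    rw [← Complex.norm_of_nonneg hε.le, ← norm_mul]
    congr 1
    have : (ε : ℂ) ≠ 0 := by exact_mod_cast hε.ne'
    push_cast
    rw [Complex.norm_of_nonneg hε.le]
    field_simp
  rw [key]
  refine ⟨(h1.comp_mul_left' (inv_ne_zero hε.ne')).const_mul _, ?_⟩
  rw [integral_const_mul, Measure.integral_comp_mul_left
    (fun y : ℝ => ‖(1 : ℂ) + y * Complex.I‖ ^ (-a)) ε⁻¹, inv_inv, abs_of_pos hε, smul_eq_mul,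
    sub_eq_add_neg, Real.rpow_add hε, Real.rpow_one]
  ring

lemma line_sub (κ y : ℝ) (ω : ℂ) : (κ : ℂ) + y * Complex.I - ω =
    ((κ - ω.re : ℝ) : ℂ) + ((y - ω.im : ℝ) : ℂ) * Complex.I := by
  apply Complex.ext <;> simp

lemma integrable_norm_line_sub_rpow {a : ℝ} (ha : 1 < a) {κ : ℝ} {ω : ℂ} (h : ω.re < κ) :
    Integrable (fun y : ℝ => ‖(κ : ℂ) + y * Complex.I - ω‖ ^ (-a)) := by
  obtain ⟨K, -, hK⟩ := integrable_norm_line_rpow ha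
  have := ((hK (κ - ω.re) (by linarith)).1).comp_sub_right ω.im
  simp only [line_sub]
  exact this

lemma line_mem_slitPlane {κ : ℝ} {ω : ℂ} (h : ω.re < κ) (y : ℝ) :
    (κ : ℂ) + y * Complex.I - ω ∈ Complex.slitPlane := by
  left; simpa using h

lemma continuous_line_cpow {κ : ℝ} {ω : ℂ} (h : ω.re < κ) (b : ℂ) :
    Continuous (fun y : ℝ => ((κ : ℂ) + y * Complex.I - ω) ^ b) := by
  refine Continuous.cpow (by fun_prop) continuous_const fun y => line_mem_slitPlane h y

lemma norm_exp_line (κ s y : ℝ) : ‖Complex.exp (((κ : ℂ) + y * Complex.I) * s)‖ =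
    Real.exp (κ * s) := by
  rw [Complex.norm_exp]; simp

lemma integrable_line_cpow {a : ℝ} (ha : 1 < a) {κ : ℝ} {ω : ℂ} (h : ω.re < κ) (s : ℝ) :
    Integrable (fun y : ℝ => Complex.exp (((κ : ℂ) + y * Complex.I) * s) *
      ((κ : ℂ) + y * Complex.I - ω) ^ (-(a : ℂ))) := by
  refine Integrable.mono' ((integrable_norm_line_sub_rpow ha h).const_mul (Real.exp (κ * s)))
    ?_ (ae_of_all _ fun y => ?_)
  · exact (Continuous.mul (by fun_prop) (continuous_line_cpow h _)).aestronglyMeasurable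
  · rw [norm_mul, norm_exp_line, ← Complex.ofReal_neg, Complex.norm_cpow_real]

/-- The inverse Laplace transform of a shifted power. -/
lemma integral_line_cpow {a : ℝ} (ha : 1 < a) {κ : ℝ} {ω : ℂ} (h : ω.re < κ) {s : ℝ}
    (hs : 0 < s) :
    ∫ y : ℝ, Complex.exp (((κ : ℂ) + y * Complex.I) * s) *
      ((κ : ℂ) + y * Complex.I - ω) ^ (-(a : ℂ)) =
    2 * Real.pi * ((s ^ (a - 1) : ℝ) : ℂ) * Complex.exp (s * ω) / (Real.Gamma a : ℂ) := by
  have ha0 : 0 < a := by linarith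
  have hΓ : (Real.Gamma a : ℂ) ≠ 0 := by exact_mod_cast (Real.Gamma_pos_of_pos ha0).ne'
  -- The line integral is, up to scaling, the inverse Fourier transform of `fourier f`. That
  -- transform is integrable because `1 < a`, so Fourier inversion applies at `s`, where `f` is
  -- continuous.
  set f : ℝ → ℂ := indicator (Ioi 0)
    (fun x : ℝ => ((x ^ (a - 1) : ℝ) : ℂ) * Complex.exp (-(((κ : ℂ) - ω) * x))) with hf
  have hre : 0 < ((κ : ℂ) - ω).re := by simpa using h
  have hfi : Integrable f :=
    (integrable_indicator_iff measurableSet_Ioi).2 (integral_rpow_mul_cexp_neg_mul_Ioi ha0 hre).1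
  have hF : ∀ w : ℝ, FourierTransform.fourier f w =
      ((κ : ℂ) + ((2 * Real.pi * w : ℝ) : ℂ) * Complex.I - ω) ^ (-(a : ℂ)) *
        (Real.Gamma a : ℂ) := by
    intro w
    have hre' : 0 < ((κ : ℂ) + ((2 * Real.pi * w : ℝ) : ℂ) * Complex.I - ω).re := by simpa using h
    rw [Real.fourier_real_eq_integral_exp_smul,
      ← (integral_rpow_mul_cexp_neg_mul_Ioi ha0 hre').2, ← integral_indicator measurableSet_Ioi]
    congr 1; ext x
    by_cases hx : x ∈ Ioi (0 : ℝ)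
    · simp only [hf, indicator_of_mem hx, smul_eq_mul]
      rw [mul_left_comm, ← Complex.exp_add]
      congr 2; push_cast; ring
    · simp [hf, indicator_of_notMem hx]
  have hFi : Integrable (FourierTransform.fourier f) := by
    have h1 := ((integrable_line_cpow ha h 0).comp_mul_left'
      (R := 2 * Real.pi) (by positivity)).mul_const (Real.Gamma a : ℂ)
    refine h1.congr (ae_of_all _ fun w => ?_)
    simp only [hF]; simp
  have hc : ContinuousAt f s := by
    have : f =ᶠ[𝓝 s] (fun x : ℝ => ((x ^ (a - 1) : ℝ) : ℂ) *
        Complex.exp (-(((κ : ℂ) - ω) * x))) := by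
      filter_upwards [lt_mem_nhds hs] with x hx
      simp [hf, indicator_of_mem (show x ∈ Ioi (0 : ℝ) from hx)]
    refine ContinuousAt.congr ?_ this.symm
    refine ContinuousAt.mul ?_ (by fun_prop)
    exact Complex.continuous_ofReal.continuousAt.comp
      (Real.continuousAt_rpow_const _ _ (Or.inl hs.ne'))
  have hinv := hfi.fourierInv_fourier_eq hFi hc
  rw [Real.fourierInv_eq'] at hinv
  simp only [hF, RCLike.inner_apply, conj_trivial, smul_eq_mul] at hinv
  have hsub := Measure.integral_comp_mul_left
    (fun y : ℝ => Complex.exp (((κ : ℂ) + y * Complex.I) * s) *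
      ((κ : ℂ) + y * Complex.I - ω) ^ (-(a : ℂ))) (2 * Real.pi)
  have hpi : (0 : ℝ) < 2 * Real.pi := by positivity
  rw [abs_of_pos (inv_pos.2 hpi), Complex.real_smul] at hsub
  have e1 : (∫ v : ℝ, Complex.exp (((κ : ℂ) + ((2 * Real.pi * v : ℝ) : ℂ) * Complex.I) * s) *
      ((κ : ℂ) + ((2 * Real.pi * v : ℝ) : ℂ) * Complex.I - ω) ^ (-(a : ℂ))) *
      (Real.Gamma a : ℂ) * Complex.exp (-(κ * s)) = f s := by
    rw [← hinv, ← integral_mul_const, ← integral_mul_const]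
    congr 1; ext v
    have : Complex.exp (((κ : ℂ) + ((2 * Real.pi * v : ℝ) : ℂ) * Complex.I) * s) *
        Complex.exp (-(κ * s)) = Complex.exp (((2 * Real.pi * (s * v) : ℝ) : ℂ) * Complex.I) := by
      rw [← Complex.exp_add]; congr 1; push_cast; ring
    rw [← this]; ring
  have e2 : f s = ((s ^ (a - 1) : ℝ) : ℂ) * Complex.exp (s * ω) * Complex.exp (-(κ * s)) := by
    simp only [hf, indicator_of_mem (show s ∈ Ioi (0 : ℝ) from hs)]
    rw [mul_assoc, ← Complex.exp_add]; congr 2; ring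
  have e3 := mul_right_cancel₀ (Complex.exp_ne_zero _) (e1.trans e2)
  rw [hsub] at e3
  rw [eq_div_iff hΓ, mul_assoc, ← e3, ← mul_assoc, ← mul_assoc, Complex.ofReal_inv]
  congr 1
  push_cast
  rw [mul_inv_cancel₀ (by simp), one_mul]

end LaplaceInversion

/-! ### Convergence of the scalar Mittag-Leffler series. -/

section Series

/-- The scalar two-parameter Mittag-Leffler function. -/
noncomputable def scalarML (p β : ℝ) (z : ℂ) : ℂ :=
  ∑' k : ℕ, (((Real.Gamma (p * k + β))⁻¹ : ℝ) : ℂ) * z ^ k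

/-- Cut the Gamma integral down to `y > T`, where `y ^ (x - 1) ≥ T ^ (x - 1)`. As `T` is free, this
beats any geometric growth. -/
lemma rpow_mul_exp_neg_le_Gamma {x T : ℝ} (hx : 1 ≤ x) (hT : 0 < T) :
    T ^ (x - 1) * Real.exp (-T) ≤ Real.Gamma x := by
  have hx0 : 0 < x := by linarith
  have hconv := Real.GammaIntegral_convergent hx0
  rw [Real.Gamma_eq_integral hx0]
  have hsub : Ioi T ⊆ Ioi (0 : ℝ) := Ioi_subset_Ioi hT.le
  calc T ^ (x - 1) * Real.exp (-T) = ∫ y in Ioi T, Real.exp (-y) * T ^ (x - 1) := by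
        rw [integral_mul_const, integral_exp_neg_Ioi, mul_comm]
    _ ≤ ∫ y in Ioi T, Real.exp (-y) * y ^ (x - 1) := by
        refine setIntegral_mono_on ?_ (hconv.mono_set hsub) measurableSet_Ioi fun y hy => ?_
        · exact (integrableOn_exp_neg_Ioi T).mul_const _
        · have : T < y := hy
          gcongr
    _ ≤ _ := by
        refine setIntegral_mono_set hconv ?_ (LE.le.eventuallyLE hsub)
        refine (ae_restrict_iff' measurableSet_Ioi).2 (ae_of_all _ fun y (hy : 0 < y) => ?_)
        simp only [Pi.zero_apply]; positivity

/-- The coefficients of the Mittag-Leffler function decay faster than any geometric sequence. -/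
lemma summable_scalarML {p β : ℝ} (hp : 0 < p) (r : ℝ) :
    Summable fun k : ℕ => ‖(((Real.Gamma (p * k + β))⁻¹ : ℝ) : ℂ)‖ * r ^ k := by
  -- Chosen so that `T ^ p ≥ 2 |r|`, which leaves a geometric series of ratio `1/2`.
  set T : ℝ := (2 * |r| + 1) ^ (1 / p) with hT
  have hb : 0 < 2 * |r| + 1 := by positivity
  have hT0 : 0 < T := Real.rpow_pos_of_pos hb _
  have hTp : T ^ p = 2 * |r| + 1 := by
    rw [hT, ← Real.rpow_mul hb.le, one_div_mul_cancel hp.ne', Real.rpow_one]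
  have hg : Summable fun k : ℕ => Real.exp T * T ^ (1 - β) * (1 / 2 : ℝ) ^ k :=
    (summable_geometric_two).mul_left _
  refine Summable.of_norm_bounded_eventually_nat hg ?_
  have htend : Tendsto (fun k : ℕ => p * (k : ℝ) + β) atTop atTop :=
    tendsto_atTop_add_const_right _ _ (tendsto_natCast_atTop_atTop.const_mul_atTop hp)
  filter_upwards [htend.eventually_ge_atTop 1] with k hk
  have h1 := rpow_mul_exp_neg_le_Gamma hk hT0
  have hG : 0 < Real.Gamma (p * k + β) := Real.Gamma_pos_of_pos (by linarith)
  rw [norm_mul, norm_norm, Complex.norm_real, Real.norm_of_nonneg (by positivity), norm_pow,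
    Real.norm_eq_abs, inv_mul_le_iff₀ hG]
  have h2 : |r| ^ k ≤ (T ^ p) ^ k * (1 / 2) ^ k := by
    rw [← mul_pow, hTp]
    gcongr
    linarith
  calc |r| ^ k ≤ (T ^ p) ^ k * (1 / 2) ^ k := h2
    _ = (T ^ (p * k + β - 1) * Real.exp (-T)) * (Real.exp T * T ^ (1 - β) * (1 / 2) ^ k) := by
        have : (T ^ p) ^ k = T ^ (p * k + β - 1) * T ^ (1 - β) := by
          rw [← Real.rpow_natCast, ← Real.rpow_mul hT0.le, ← Real.rpow_add hT0]; congr 1; ring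
        rw [this]
        have h3 : Real.exp (-T) * Real.exp T = 1 := by rw [← Real.exp_add]; simp
        linear_combination (-(T ^ (p * k + β - 1) * T ^ (1 - β) * (1 / 2) ^ k)) * h3
    _ ≤ _ := by gcongr

lemma hasSum_scalarML {p β : ℝ} (hp : 0 < p) (z : ℂ) :
    HasSum (fun k : ℕ => (((Real.Gamma (p * k + β))⁻¹ : ℝ) : ℂ) * z ^ k) (scalarML p β z) := by
  refine Summable.hasSum (Summable.of_norm ?_)
  simpa using summable_scalarML (β := β) hp ‖z‖

end Series

/-! ### The second derivative of the resolvent symbol and its inverse Laplace transform. -/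

section Symbol

/-- The second derivative of `σ ↦ 1 / (σ ^ p - lam)`. -/
noncomputable def resolventDeriv2 (p : ℝ) (lam σ : ℂ) : ℂ :=
  (p * (1 - p) * σ ^ (p : ℂ) / (σ ^ (p : ℂ) - lam) ^ 2 +
    2 * p ^ 2 * (σ ^ (p : ℂ)) ^ 2 / (σ ^ (p : ℂ) - lam) ^ 3) / σ ^ 2

/-- Expand `1/(σ^p - lam)` in powers of `lam σ^(-p)` and differentiate twice. The coefficient splits
as `(p - p^2)(k+1) + 2 p^2 choose(k+2, 2)`, matching the two terms of the closed form. -/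
lemma hasSum_resolventDeriv2 {p : ℝ} {lam σ : ℂ} (hσ : σ ≠ 0)
    (h : ‖lam‖ < ‖σ ^ (p : ℂ)‖) :
    HasSum (fun k : ℕ => ((p * (k + 1) * (p * (k + 1) + 1) : ℝ) : ℂ) * lam ^ k *
      σ ^ (-((p * (k + 1) + 2 : ℝ) : ℂ))) (resolventDeriv2 p lam σ) := by
  set S := σ ^ (p : ℂ) with hS
  have hS0 : S ≠ 0 := by
    intro h0; rw [h0, norm_zero] at h; exact absurd h (not_lt.2 (norm_nonneg _))
  have hq : ‖lam / S‖ < 1 := by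
    rw [norm_div, div_lt_one (norm_pos_iff.2 hS0)]; exact h
  have hsub : S - lam ≠ 0 := by
    intro h0; rw [sub_eq_zero.1 h0] at h; exact lt_irrefl _ h
  have h1 := (hasSum_choose_mul_geometric_of_norm_lt_one 1 hq).mul_left ((p : ℂ) - p ^ 2)
  have h2 := (hasSum_choose_mul_geometric_of_norm_lt_one 2 hq).mul_left (2 * (p : ℂ) ^ 2)
  have h3 := (h1.add h2).mul_right (S⁻¹ / σ ^ 2)
  convert! h3 using 1
  · ext k
    have e1 : σ ^ (-((p * (k + 1) + 2 : ℝ) : ℂ)) = (S ^ (k + 1))⁻¹ * (σ ^ 2)⁻¹ := by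
      have : (-((p * (k + 1) + 2 : ℝ) : ℂ)) = -((p : ℂ) * ((k + 1 : ℕ) : ℂ)) + -((2 : ℕ) : ℂ) := by
        push_cast; ring
      rw [this, Complex.cpow_add _ _ hσ, Complex.cpow_neg, Complex.cpow_neg, Complex.cpow_natCast,
        Complex.cpow_mul_nat]
    have e2 : (((k + 2).choose 2 : ℕ) : ℂ) = (k + 2) * (k + 1) / 2 := by
      rw [Nat.cast_choose_two]; push_cast; ring
    rw [e1, e2, Nat.choose_one_right, div_pow]
    push_cast
    field_simp
    ring
  · rw [resolventDeriv2, ← hS]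
    have : 1 - lam / S ≠ 0 := by
      rw [one_sub_div hS0]; exact div_ne_zero hsub hS0
    rw [one_sub_div hS0] at this ⊢
    generalize S - lam = D at *
    clear_value S
    norm_num only
    field_simp

/-- Near `0` the exponent `p - 2` is the true order; at infinity it is weaker than the true `-p -
2`, but still integrable along lines since `p < 1`. One bound of pure power type serves both ends
and scales well under a change of line. -/
lemma norm_resolventDeriv2_le {p : ℝ} (hp0 : 0 < p) (hp1 : p < 1) {lam σ : ℂ} (hσ : σ ≠ 0)
    {d : ℝ} (hd : 0 < d) (h1 : d ≤ ‖σ ^ (p : ℂ) - lam‖)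
    (h2 : d * ‖σ ^ (p : ℂ)‖ ≤ ‖σ ^ (p : ℂ) - lam‖) :
    ‖resolventDeriv2 p lam σ‖ ≤ (1 / d ^ 2 + 2 / d ^ 3) * ‖σ‖ ^ (p - 2) := by
  have hS : ‖σ ^ (p : ℂ)‖ = ‖σ‖ ^ p := Complex.norm_cpow_real _ _
  have hσ0 : 0 < ‖σ‖ := norm_pos_iff.2 hσ
  set x := ‖σ ^ (p : ℂ)‖ with hx
  set y := ‖σ ^ (p : ℂ) - lam‖ with hy
  have hx0 : 0 < x := by rw [hS]; positivity
  have hy0 : 0 < y := lt_of_lt_of_le hd h1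
  have hpow : ‖σ‖ ^ (p - 2) = x / ‖σ‖ ^ 2 := by
    rw [hS, Real.rpow_sub hσ0]; norm_num
  rw [resolventDeriv2, norm_div, hpow, norm_pow, ← mul_div_assoc]
  gcongr
  refine (norm_add_le _ _).trans ?_
  rw [norm_div, norm_div, norm_mul, norm_mul, norm_pow, norm_mul, norm_mul, norm_pow, norm_pow,
    norm_pow, ← hx, ← hy]
  have hpn : ‖(p : ℂ)‖ = p := by rw [Complex.norm_real, Real.norm_of_nonneg hp0.le]
  have hpn' : ‖(1 - p : ℂ)‖ = 1 - p := by
    rw [← Complex.ofReal_one, ← Complex.ofReal_sub, Complex.norm_real,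
      Real.norm_of_nonneg (by linarith)]
  rw [hpn, hpn', Complex.norm_two, add_mul]
  refine add_le_add ?_ ?_
  · rw [div_mul_eq_mul_div]
    gcongr
    nlinarith
  · rw [div_mul_eq_mul_div, div_le_div_iff₀ (by positivity) (by positivity)]
    have hp2 : p ^ 2 ≤ 1 := by nlinarith
    have h4 : d ^ 3 * x ≤ y ^ 3 := by
      calc d ^ 3 * x = d ^ 2 * (d * x) := by ring
        _ ≤ y ^ 2 * y := by gcongr
        _ = y ^ 3 := by ring
    calc 2 * p ^ 2 * x ^ 2 * d ^ 3 = 2 * p ^ 2 * x * (d ^ 3 * x) := by ring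
      _ ≤ 2 * 1 * x * y ^ 3 := by gcongr
      _ = 2 * x * y ^ 3 := by ring

lemma Gamma_add_two {a : ℝ} (ha : 0 < a) :
    Real.Gamma (a + 2) = a * (a + 1) * Real.Gamma a := by
  have h : a + 2 = (a + 1) + 1 := by ring
  rw [h, Real.Gamma_add_one (by linarith), Real.Gamma_add_one ha.ne']; ring

/-- Inverse Laplace transform of the second derivative of the resolvent symbol. -/
lemma integral_line_resolventDeriv2 {p : ℝ} (hp : 0 < p) {lam : ℂ} {κ : ℝ} (hκ : 0 < κ)
    (hlam : ‖lam‖ < κ ^ p) {s : ℝ} (hs : 0 < s) :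
    ∫ y : ℝ, Complex.exp (((κ : ℂ) + y * Complex.I) * s) *
        resolventDeriv2 p lam ((κ : ℂ) + y * Complex.I) =
      2 * Real.pi * ((s ^ (p + 1) : ℝ) : ℂ) * scalarML p p (((s ^ p : ℝ) : ℂ) * lam) := by
  set F : ℕ → ℝ → ℂ := fun k y => ((p * (k + 1) * (p * (k + 1) + 1) : ℝ) : ℂ) * lam ^ k *
    (Complex.exp (((κ : ℂ) + y * Complex.I) * s) *
      ((κ : ℂ) + y * Complex.I - 0) ^ (-((p * (k + 1) + 2 : ℝ) : ℂ))) with hF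
  have ha : ∀ k : ℕ, 0 < p * ((k : ℝ) + 1) := fun k => by positivity
  have hκ' : (0 : ℂ).re < κ := by simpa using hκ
  have hre : ∀ y : ℝ, κ ≤ ‖(κ : ℂ) + y * Complex.I‖ := fun y => by
    have := Complex.re_le_norm ((κ : ℂ) + y * Complex.I)
    simpa using this
  have hne : ∀ y : ℝ, (κ : ℂ) + y * Complex.I ≠ 0 := fun y => by
    rw [← norm_pos_iff]; exact hκ.trans_le (hre y)
  have hint : ∀ k, Integrable (F k) := fun k =>
    (integrable_line_cpow (a := p * (k + 1) + 2) (by linarith [ha k]) hκ' s).const_mul _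
  have hsum : Summable fun k => ∫ y, ‖F k y‖ := by
    set q := ‖lam‖ / κ ^ p with hq
    have hκp : 0 < κ ^ p := by positivity
    have hq1 : ‖q‖ < 1 := by
      rw [Real.norm_of_nonneg (by positivity), hq, div_lt_one hκp]; exact hlam
    have hs1 := (hasSum_choose_mul_geometric_of_norm_lt_one 1 hq1).summable.mul_left (p - p ^ 2)
    have hs2 := (hasSum_choose_mul_geometric_of_norm_lt_one 2 hq1).summable.mul_left (2 * p ^ 2)
    have hs3 := (hs1.add hs2).mul_right
      (Real.exp (κ * s) * ∫ y : ℝ, ‖(κ : ℂ) + y * Complex.I - 0‖ ^ (-(p + 2)))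
    refine Summable.of_nonneg_of_le (fun k => integral_nonneg fun y => norm_nonneg _) (fun k => ?_)
      hs3
    rw [← integral_const_mul, ← integral_const_mul]
    refine integral_mono (hint k).norm
      (((integrable_norm_line_sub_rpow (by linarith) hκ').const_mul _).const_mul _) fun y => ?_
    simp only [hF, sub_zero]
    rw [norm_mul, norm_mul, norm_mul, norm_exp_line, ← Complex.ofReal_neg, Complex.norm_cpow_real,
      Complex.norm_real, Real.norm_of_nonneg (by have := ha k; positivity), norm_pow]
    have e2 : (((k + 2).choose 2 : ℕ) : ℝ) = (k + 2) * (k + 1) / 2 := by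
      rw [Nat.cast_choose_two]; push_cast; ring
    rw [e2, Nat.choose_one_right]
    -- The `k`-dependent part of the exponent is traded for `κ ^ (-p k)`, since `|σ| ≥ κ` on the
    -- line; with `‖lam‖ < κ ^ p` the series of integrals is then dominated geometrically.
    have e3 : ‖(κ : ℂ) + y * Complex.I‖ ^ (-(p * (k + 1) + 2)) ≤
        (κ ^ p)⁻¹ ^ k * ‖(κ : ℂ) + y * Complex.I‖ ^ (-(p + 2)) := by
      have h0 : 0 < ‖(κ : ℂ) + y * Complex.I‖ := hκ.trans_le (hre y)
      have : -(p * (k + 1) + 2) = -(p * k) + -(p + 2) := by ring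
      rw [this, Real.rpow_add h0, ← Real.rpow_neg hκ.le, ← Real.rpow_natCast, ← Real.rpow_mul hκ.le,
        neg_mul]
      gcongr ?_ * _
      exact Real.rpow_le_rpow_of_nonpos hκ (hre y) (by
        have : 0 ≤ p * (k : ℝ) := by positivity
        linarith)
    calc p * (k + 1) * (p * (k + 1) + 1) * ‖lam‖ ^ k * (Real.exp (κ * s) *
          ‖(κ : ℂ) + y * Complex.I‖ ^ (-(p * (k + 1) + 2)))
        ≤ p * (k + 1) * (p * (k + 1) + 1) * ‖lam‖ ^ k * (Real.exp (κ * s) *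
          ((κ ^ p)⁻¹ ^ k * ‖(κ : ℂ) + y * Complex.I‖ ^ (-(p + 2)))) := by gcongr
      _ = _ := by
        rw [hq, div_eq_mul_inv, mul_pow]; push_cast; ring
  have h := hasSum_integral_of_summable_integral_norm hint hsum
  have hl : ∀ y, ∑' k, F k y = Complex.exp (((κ : ℂ) + y * Complex.I) * s) *
      resolventDeriv2 p lam ((κ : ℂ) + y * Complex.I) := by
    intro y
    have hn : ‖lam‖ < ‖((κ : ℂ) + y * Complex.I) ^ (p : ℂ)‖ := by
      rw [Complex.norm_cpow_real]
      exact hlam.trans_le (Real.rpow_le_rpow hκ.le (hre y) hp.le)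
    rw [← ((hasSum_resolventDeriv2 (hne y) hn).mul_left _).tsum_eq]
    congr 1; ext k
    simp only [hF, sub_zero]; ring
  simp only [hl] at h
  refine h.unique ?_
  have h2 := (hasSum_scalarML (β := p) hp (((s ^ p : ℝ) : ℂ) * lam)).mul_left
    (2 * Real.pi * ((s ^ (p + 1) : ℝ) : ℂ))
  convert! h2 using 2 with k
  simp only [hF]
  rw [integral_const_mul, integral_line_cpow (by linarith [ha k]) hκ' hs, Gamma_add_two (ha k)]
  have hΓ : (Real.Gamma (p * (k + 1)) : ℂ) ≠ 0 := by
    exact_mod_cast (Real.Gamma_pos_of_pos (ha k)).ne'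
  have e4 : s ^ (p * (k + 1) + 2 - 1) = s ^ (p + 1) * (s ^ p) ^ k := by
    rw [← Real.rpow_natCast, ← Real.rpow_mul hs.le, ← Real.rpow_add hs]; congr 1; ring
  have e5 : p * (k : ℝ) + p = p * (k + 1) := by ring
  have h6 : ((p * (k + 1) : ℝ) : ℂ) ≠ 0 := by exact_mod_cast (ha k).ne'
  have h7 : ((p * (k + 1) + 1 : ℝ) : ℂ) ≠ 0 := by
    exact_mod_cast (by linarith [ha k] : (0 : ℝ) < p * (k + 1) + 1).ne'
  rw [e4, e5, mul_zero, Complex.exp_zero]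
  simp only [Complex.ofReal_mul _ (Real.Gamma _), Complex.ofReal_mul (p * (k + 1)) (p * (k + 1) + 1),
    Complex.ofReal_inv, Complex.ofReal_mul (s ^ (p + 1)), Complex.ofReal_pow, mul_pow]
  field_simp

end Symbol

/-! ### Shifting vertical lines of integration. -/

section Contour

/-- Vertical line integrals of a function holomorphic on the right half plane agree, if it decays. -/
lemma integral_line_eq_of_decay {f : ℂ → ℂ} (hf : DifferentiableOn ℂ f {σ | 0 < σ.re})
    {ε κ : ℝ} (hε : 0 < ε) (hεκ : ε ≤ κ)
    (h1 : Integrable fun y : ℝ => f (ε + y * Complex.I))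
    (h2 : Integrable fun y : ℝ => f (κ + y * Complex.I))
    {C a Y : ℝ} (ha : 0 < a)
    (hdec : ∀ x y : ℝ, ε ≤ x → x ≤ κ → Y ≤ |y| → ‖f (x + y * Complex.I)‖ ≤ C * |y| ^ (-a)) :
    ∫ y : ℝ, f (ε + y * Complex.I) = ∫ y : ℝ, f (κ + y * Complex.I) := by
  -- Cauchy's theorem on the rectangle of height `2 T`; its horizontal sides vanish as `T → ∞` by
  -- the decay.
  have hrect : ∀ T : ℝ, 0 < T →
      Complex.I * (∫ y in (-T)..T, f (κ + y * Complex.I)) -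
        Complex.I * (∫ y in (-T)..T, f (ε + y * Complex.I)) =
      (∫ x in ε..κ, f (x + (T : ℝ) * Complex.I)) -
        ∫ x in ε..κ, f (x + ((-T : ℝ) : ℂ) * Complex.I) := by
    intro T hT
    have h := Complex.integral_boundary_rect_eq_zero_of_differentiableOn f ⟨ε, -T⟩ ⟨κ, T⟩
      (hf.mono fun σ hσ => by
        have : σ.re ∈ uIcc ε κ := hσ.1
        rw [uIcc_of_le hεκ] at this
        exact hε.trans_le this.1)
    simp only [smul_eq_mul] at h
    linear_combination h
  have hT1 : Tendsto (fun T : ℝ => Complex.I * (∫ y in (-T)..T, f (κ + y * Complex.I)) -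
        Complex.I * (∫ y in (-T)..T, f (ε + y * Complex.I))) atTop
      (𝓝 (Complex.I * (∫ y : ℝ, f (κ + y * Complex.I)) -
        Complex.I * ∫ y : ℝ, f (ε + y * Complex.I))) :=
    ((intervalIntegral_tendsto_integral h2 tendsto_neg_atTop_atBot tendsto_id).const_mul _).sub
      ((intervalIntegral_tendsto_integral h1 tendsto_neg_atTop_atBot tendsto_id).const_mul _)
  have hT2 : Tendsto (fun T : ℝ => (∫ x in ε..κ, f (x + (T : ℝ) * Complex.I)) -
        ∫ x in ε..κ, f (x + ((-T : ℝ) : ℂ) * Complex.I)) atTop (𝓝 0) := by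
    have hz : Tendsto (fun T : ℝ => 2 * (C * T ^ (-a) * |κ - ε|)) atTop (𝓝 0) := by
      have := (((tendsto_rpow_neg_atTop ha).const_mul C).mul_const |κ - ε|).const_mul 2
      simpa using this
    refine squeeze_zero_norm' ?_ hz
    filter_upwards [eventually_ge_atTop Y, eventually_gt_atTop 0] with T hTY hT0
    have hb : ∀ y : ℝ, |y| = T → ‖∫ x in ε..κ, f (x + (y : ℝ) * Complex.I)‖ ≤
        C * T ^ (-a) * |κ - ε| := by
      intro y hy
      refine intervalIntegral.norm_integral_le_of_norm_le_const fun x hx => ?_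
      rw [uIoc_of_le hεκ] at hx
      rw [← hy]
      exact hdec x y hx.1.le hx.2 (by rw [hy]; exact hTY)
    refine (norm_sub_le _ _).trans ?_
    rw [two_mul]
    exact add_le_add (hb T (abs_of_pos hT0)) (hb (-T) (by rw [abs_neg, abs_of_pos hT0]))
  have hev : (fun T : ℝ => (∫ x in ε..κ, f (x + (T : ℝ) * Complex.I)) -
        ∫ x in ε..κ, f (x + ((-T : ℝ) : ℂ) * Complex.I)) =ᶠ[atTop]
      (fun T : ℝ => Complex.I * (∫ y in (-T)..T, f (κ + y * Complex.I)) -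
        Complex.I * (∫ y in (-T)..T, f (ε + y * Complex.I))) := by
    filter_upwards [eventually_gt_atTop 0] with T hT using (hrect T hT).symm
  have := tendsto_nhds_unique hT1 (hT2.congr' hev)
  have h3 := mul_left_cancel₀ Complex.I_ne_zero (sub_eq_zero.1 this)
  exact h3.symm

end Contour

/-! ### The root `lam ^ (1/p)` on the unstable sector. -/

section Roots

/-- The open sector of the unstable eigenvalues. -/
def unstableSector (p : ℝ) : Set ℂ := {lam | lam ≠ 0 ∧ |Complex.arg lam| < p * Real.pi / 2}

variable {p : ℝ} {lam : ℂ}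

lemma unstableSector_subset_slitPlane (hp1 : p < 1) :
    unstableSector p ⊆ Complex.slitPlane := by
  rintro z ⟨h0, h⟩
  rw [Complex.mem_slitPlane_iff_arg]
  refine ⟨fun h1 => ?_, h0⟩
  rw [h1, abs_of_pos Real.pi_pos] at h
  nlinarith [Real.pi_pos]

lemma isOpen_unstableSector (hp1 : p < 1) : IsOpen (unstableSector p) := by
  rw [isOpen_iff_mem_nhds]
  intro z hz
  have hc : ContinuousAt (fun w => |Complex.arg w|) z :=
    (Complex.continuousAt_arg (unstableSector_subset_slitPlane hp1 hz)).abs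
  filter_upwards [hc.eventually_lt continuousAt_const hz.2, isOpen_ne.mem_nhds hz.1] with w h1 h2
  exact ⟨h2, h1⟩

lemma log_root_im (h : lam ∈ unstableSector p) (hp0 : 0 < p) :
    |(Complex.log lam * (1 / (p : ℂ))).im| < Real.pi / 2 := by
  have : (1 / (p : ℂ)) = ((1 / p : ℝ) : ℂ) := by push_cast; rfl
  rw [this, Complex.im_mul_ofReal, Complex.log_im, abs_mul, abs_of_pos (one_div_pos.2 hp0),
    mul_one_div, div_lt_iff₀ hp0]
  have := h.2
  linarith

lemma root_ne_zero (h : lam ≠ 0) : lam ^ (1 / (p : ℂ)) ≠ 0 := by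
  simp [Complex.cpow_eq_zero_iff, h]

lemma root_re_pos (h : lam ∈ unstableSector p) (hp0 : 0 < p) :
    0 < (lam ^ (1 / (p : ℂ))).re := by
  rw [Complex.cpow_def_of_ne_zero h.1, Complex.exp_re]
  have := abs_lt.1 (log_root_im h hp0)
  exact mul_pos (Real.exp_pos _) (Real.cos_pos_of_mem_Ioo ⟨by linarith, this.2⟩)

lemma root_cpow_of_mem (h : lam ∈ unstableSector p) (hp0 : 0 < p) :
    (lam ^ (1 / (p : ℂ))) ^ (p : ℂ) = lam := by
  have := abs_lt.1 (log_root_im h hp0)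
  rw [← Complex.cpow_mul _ (by linarith [Real.pi_pos]) (by linarith [Real.pi_pos]),
    one_div_mul_cancel (by exact_mod_cast hp0.ne'), Complex.cpow_one]

/-- As `p < 1`, multiplying the argument by `p` stays within `(-π, π]`, so the principal root undoes
the principal power. Hence `σ^p = lam` has no solution other than the principal root. -/
lemma eq_root_of_cpow_eq (hp0 : 0 < p) (hp1 : p < 1) {σ : ℂ}
    (h : σ ^ (p : ℂ) = lam) : σ = lam ^ (1 / (p : ℂ)) := by
  have h1 := Complex.neg_pi_lt_arg σ
  have h2 := Complex.arg_le_pi σ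
  rw [← h, ← Complex.cpow_mul, mul_one_div_cancel (by exact_mod_cast hp0.ne'), Complex.cpow_one]
  · rw [Complex.im_mul_ofReal, Complex.log_im]; nlinarith [Real.pi_pos]
  · rw [Complex.im_mul_ofReal, Complex.log_im]; nlinarith [Real.pi_pos]

end Roots

/-! ### The exponential and remainder kernels, and removal of the pole. -/

section Kernel

/-- `lam ^ (1 / p) / (p lam) * exp (u lam ^ (1 / p))`, the exponential part of the kernel. -/
noncomputable def expKernel (p u : ℝ) (lam : ℂ) : ℂ :=
  lam ^ (1 / (p : ℂ)) / (p * lam) * Complex.exp (u * lam ^ (1 / (p : ℂ)))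

/-- The algebraically decaying part of the kernel. -/
noncomputable def remKernel (p s : ℝ) (lam : ℂ) : ℂ :=
  ((s ^ (p - 1) : ℝ) : ℂ) * scalarML p p (((s ^ p : ℝ) : ℂ) * lam) - expKernel p s lam

/-- The second derivative of `σ ↦ 1 / (σ ^ p - lam)` without its pole. -/
noncomputable def regularDeriv2 (p : ℝ) (lam σ : ℂ) : ℂ :=
  resolventDeriv2 p lam σ -
    2 * (lam ^ (1 / (p : ℂ)) / (p * lam)) * ((σ - lam ^ (1 / (p : ℂ))) ^ 3)⁻¹

variable {p : ℝ} {lam : ℂ}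

lemma hasDerivAt_cpow_const' {σ : ℂ} (hσ : σ ∈ Complex.slitPlane) :
    HasDerivAt (fun z : ℂ => z ^ (p : ℂ)) (p * σ ^ (p : ℂ) / σ) σ := by
  have := (hasDerivAt_id' σ).cpow_const (c := (p : ℂ)) hσ
  convert! this using 1
  rw [Complex.cpow_sub _ _ (Complex.slitPlane_ne_zero hσ), Complex.cpow_one, mul_one,
    mul_div_assoc]

/-- Write `σ^p - lam = (σ - ω) q(σ)` with `q` holomorphic and zero-free on the right half plane. The
difference quotient of `1/q` at `ω` is the resolvent minus its simple pole, of residue `1/q(ω) =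
ω/(p lam)`; `W` is its second derivative. -/
lemma exists_regular_extension (hp0 : 0 < p) (hp1 : p < 1) (h : lam ∈ unstableSector p) :
    ∃ W : ℂ → ℂ, DifferentiableOn ℂ W {σ | 0 < σ.re} ∧
      ∀ σ : ℂ, 0 < σ.re → σ ≠ lam ^ (1 / (p : ℂ)) → W σ = regularDeriv2 p lam σ := by
  set ω := lam ^ (1 / (p : ℂ)) with hω
  set U : Set ℂ := {σ | 0 < σ.re} with hU
  have hUo : IsOpen U := isOpen_lt continuous_const Complex.continuous_re
  have hωU : ω ∈ U := root_re_pos h hp0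
  have hslit : U ⊆ Complex.slitPlane := fun σ hσ => Or.inl hσ
  have hωp : ω ^ (p : ℂ) = lam := root_cpow_of_mem h hp0
  have hω0 : ω ≠ 0 := root_ne_zero h.1
  have hpc : (p : ℂ) ≠ 0 := by exact_mod_cast hp0.ne'
  set q := dslope (fun z : ℂ => z ^ (p : ℂ)) ω with hq
  have hqd : DifferentiableOn ℂ q U := by
    rw [Complex.differentiableOn_dslope (hUo.mem_nhds hωU)]
    exact fun σ hσ => (hasDerivAt_cpow_const' (hslit hσ)).differentiableAt.differentiableWithinAt
  have hqω : q ω = p * lam / ω := by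
    rw [hq, dslope_same, (hasDerivAt_cpow_const' (hslit hωU)).deriv, hωp]
  have hqσ : ∀ σ, (σ - ω) * q σ = σ ^ (p : ℂ) - lam := by
    intro σ
    have := sub_smul_dslope (fun z : ℂ => z ^ (p : ℂ)) ω σ
    rw [smul_eq_mul, hωp] at this
    exact this
  have hS : ∀ σ ∈ U, σ ≠ ω → σ ^ (p : ℂ) - lam ≠ 0 := by
    intro σ hσ hne h0
    exact hne (eq_root_of_cpow_eq hp0 hp1 (sub_eq_zero.1 h0))
  have hq0 : ∀ σ ∈ U, q σ ≠ 0 := by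
    intro σ hσ
    rcases eq_or_ne σ ω with rfl | hne
    · rw [hqω]; exact div_ne_zero (mul_ne_zero hpc h.1) hω0
    · intro h0
      refine hS σ hσ hne ?_
      rw [← hqσ, h0, mul_zero]
  set R := dslope (fun σ => (q σ)⁻¹) ω with hR
  have hRd : DifferentiableOn ℂ R U := by
    rw [Complex.differentiableOn_dslope (hUo.mem_nhds hωU)]
    exact hqd.inv hq0
  have hRσ : ∀ σ ∈ U, σ ≠ ω → R σ = (σ ^ (p : ℂ) - lam)⁻¹ - ω / (p * lam) * (σ - ω)⁻¹ := by
    intro σ hσ hne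
    rw [hR, dslope_of_ne _ hne, slope_def_field, hqω, ← hqσ, inv_div]
    have := sub_ne_zero.2 hne
    have := hq0 σ hσ
    field_simp
  refine ⟨deriv (deriv R), (hRd.deriv hUo).deriv hUo, ?_⟩
  set V : Set ℂ := U ∩ {ω}ᶜ with hV
  have hVo : IsOpen V := hUo.inter isOpen_compl_singleton
  have hd1 : ∀ σ ∈ V, deriv R σ = -(p * σ ^ (p : ℂ) / σ) / (σ ^ (p : ℂ) - lam) ^ 2 +
      ω / (p * lam) * ((σ - ω) ^ 2)⁻¹ := by
    intro σ hσ
    have heq : R =ᶠ[𝓝 σ] fun σ => (σ ^ (p : ℂ) - lam)⁻¹ - ω / (p * lam) * (σ - ω)⁻¹ := by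
      filter_upwards [hVo.mem_nhds hσ] with z hz using hRσ z hz.1 hz.2
    rw [heq.deriv_eq]
    have e1 := ((hasDerivAt_cpow_const' (p := p) (hslit hσ.1)).sub_const lam).fun_inv (hS σ hσ.1 hσ.2)
    have e2 := (((hasDerivAt_id' σ).sub_const ω).fun_inv (sub_ne_zero.2 hσ.2)).const_mul
      (ω / (p * lam))
    refine ((e1.sub e2).deriv).trans ?_
    ring
  intro σ hσ hne
  have hσV : σ ∈ V := ⟨hσ, hne⟩
  have heq : deriv R =ᶠ[𝓝 σ] fun σ => -(p * σ ^ (p : ℂ) / σ) / (σ ^ (p : ℂ) - lam) ^ 2 +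
      ω / (p * lam) * ((σ - ω) ^ 2)⁻¹ := by
    filter_upwards [hVo.mem_nhds hσV] with z hz using hd1 z hz
  rw [heq.deriv_eq]
  have hσ0 : σ ≠ 0 := Complex.slitPlane_ne_zero (hslit hσ)
  have hs0 := hS σ hσ hne
  have hsub := sub_ne_zero.2 hne
  have e0 := hasDerivAt_cpow_const' (p := p) (hslit hσ)
  have e1 := ((e0.const_mul (p : ℂ)).div (hasDerivAt_id' σ) hσ0).neg.div
    ((e0.sub_const lam).fun_pow 2) (pow_ne_zero 2 hs0)
  have e2 := ((((hasDerivAt_id' σ).sub_const ω).fun_pow 2).fun_inv (pow_ne_zero 2 hsub)).const_mul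
      (ω / (p * lam))
  have e3 := (e1.add e2).deriv
  refine Eq.trans e3 ?_
  rw [regularDeriv2, resolventDeriv2, ← hω]
  simp only [Pi.neg_apply, Pi.div_apply]
  have hl := h.1
  generalize σ ^ (p : ℂ) = S at hs0 ⊢
  generalize ω = w at hsub ⊢
  field_simp
  ring

lemma norm_regularDeriv2_le (hp0 : 0 < p) (hp1 : p < 1) {σ : ℂ} (hσ : σ ≠ 0)
    {d : ℝ} (hd : 0 < d) (h1 : d ≤ ‖σ ^ (p : ℂ) - lam‖)
    (h2 : d * ‖σ ^ (p : ℂ)‖ ≤ ‖σ ^ (p : ℂ) - lam‖)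
    (h3 : d ≤ ‖σ - lam ^ (1 / (p : ℂ))‖) (h4 : d * ‖σ‖ ≤ ‖σ - lam ^ (1 / (p : ℂ))‖) :
    ‖regularDeriv2 p lam σ‖ ≤
      (1 / d ^ 2 + 2 / d ^ 3 + 2 * ‖lam ^ (1 / (p : ℂ)) / (p * lam)‖ / d ^ 3) * ‖σ‖ ^ (p - 2) := by
  set ω := lam ^ (1 / (p : ℂ)) with hω
  rw [regularDeriv2, ← hω, add_mul]
  refine (norm_sub_le _ _).trans (add_le_add (norm_resolventDeriv2_le hp0 hp1 hσ hd h1 h2) ?_)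
  rw [norm_mul, norm_mul, Complex.norm_two, norm_inv, norm_pow, div_mul_eq_mul_div, mul_div_assoc]
  gcongr
  have hσ0 : 0 < ‖σ‖ := norm_pos_iff.2 hσ
  have hx : 0 < ‖σ - ω‖ := hd.trans_le h3
  rw [inv_eq_one_div, div_le_div_iff₀ (by positivity) (by positivity), one_mul]
  -- The pole term is bounded by `d^(-3) min(1, |σ|^(-3))`, which lies below `d^(-3) |σ|^(p-2)`
  -- because `-3 < p - 2 < 0`.
  rcases le_total ‖σ‖ 1 with h | h
  · have : 1 ≤ ‖σ‖ ^ (p - 2) := Real.one_le_rpow_of_pos_of_le_one_of_nonpos hσ0 h (by linarith)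
    calc d ^ 3 = 1 * d ^ 3 := by ring
      _ ≤ ‖σ‖ ^ (p - 2) * ‖σ - ω‖ ^ 3 := by gcongr
  · have : (‖σ‖ ^ 3)⁻¹ ≤ ‖σ‖ ^ (p - 2) := by
      rw [← Real.rpow_natCast, ← Real.rpow_neg hσ0.le]
      exact Real.rpow_le_rpow_of_exponent_le h (by norm_num; linarith)
    calc d ^ 3 = (‖σ‖ ^ 3)⁻¹ * (d * ‖σ‖) ^ 3 := by field_simp
      _ ≤ ‖σ‖ ^ (p - 2) * ‖σ - ω‖ ^ 3 := by gcongr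

end Kernel

/-! ### Distance from the strip near the imaginary axis to the singularities. -/

section Separation

/-- Quantitative separation of `σ` from the singularities of the symbol. -/
def Separated (p d : ℝ) (lam σ : ℂ) : Prop :=
  σ ≠ 0 ∧ d ≤ ‖σ ^ (p : ℂ) - lam‖ ∧ d * ‖σ ^ (p : ℂ)‖ ≤ ‖σ ^ (p : ℂ) - lam‖ ∧
    d ≤ ‖σ - lam ^ (1 / (p : ℂ))‖ ∧ d * ‖σ‖ ≤ ‖σ - lam ^ (1 / (p : ℂ))‖

variable {p d : ℝ} {lam : ℂ}

lemma Separated.anti {d' : ℝ} {σ : ℂ} (hdd : d' ≤ d) (h : Separated p d lam σ) :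
    Separated p d' lam σ :=
  ⟨h.1, hdd.trans h.2.1, (mul_le_mul_of_nonneg_right hdd (norm_nonneg _)).trans h.2.2.1,
    hdd.trans h.2.2.2.1, (mul_le_mul_of_nonneg_right hdd (norm_nonneg _)).trans h.2.2.2.2⟩

lemma norm_root_rpow (hp0 : 0 < p) (h : lam ∈ unstableSector p) :
    ‖lam ^ (1 / (p : ℂ))‖ ^ p = ‖lam‖ := by
  rw [← Complex.norm_cpow_real, root_cpow_of_mem h hp0]

/-- For such `σ` both `σ^p` and `σ` have at least twice the modulus of `lam` and of its root, the
latter because `2^p ≤ 2`. -/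
lemma separated_of_large (hp0 : 0 < p) (hp1 : p < 1) (h : lam ∈ unstableSector p) {ρ : ℝ}
    (hρ0 : 1 ≤ ρ) (hρ : 2 * ‖lam‖ ≤ ρ ^ p) {σ : ℂ} (hσ : ρ ≤ ‖σ‖) :
    Separated p (1 / 2) lam σ := by
  have hρp : 1 ≤ ρ ^ p := Real.one_le_rpow hρ0 hp0.le
  have hS : ρ ^ p ≤ ‖σ ^ (p : ℂ)‖ := by
    rw [Complex.norm_cpow_real]; exact Real.rpow_le_rpow (by linarith) hσ hp0.le
  have h1 : ‖σ ^ (p : ℂ)‖ - ‖lam‖ ≤ ‖σ ^ (p : ℂ) - lam‖ := norm_sub_norm_le _ _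
  have h2 : ‖σ‖ - ‖lam ^ (1 / (p : ℂ))‖ ≤ ‖σ - lam ^ (1 / (p : ℂ))‖ := norm_sub_norm_le _ _
  have h3 : 2 * ‖lam ^ (1 / (p : ℂ))‖ ≤ ρ := by
    refine (Real.rpow_le_rpow_iff (by positivity) (by linarith) hp0).1 (le_trans ?_ hρ)
    rw [Real.mul_rpow (by norm_num) (norm_nonneg _), norm_root_rpow hp0 h]
    gcongr
    calc (2 : ℝ) ^ p ≤ 2 ^ (1 : ℝ) := Real.rpow_le_rpow_of_exponent_le (by norm_num) hp1.le
      _ = 2 := by norm_num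
  refine ⟨fun h0 => ?_, ?_, ?_, ?_, ?_⟩
  · rw [h0, norm_zero] at hσ; linarith
  all_goals linarith

/-- Locally uniform separation of a strip along the imaginary axis from the singularities. -/
lemma exists_separated_strip (hp0 : 0 < p) (hp1 : p < 1) {lam₀ : ℂ}
    (h : lam₀ ∈ unstableSector p) :
    ∃ r > 0, ∃ d > 0, ∃ η > 0, ∃ c : ℝ, Metric.closedBall lam₀ r ⊆ unstableSector p ∧
      ∀ lam ∈ Metric.closedBall lam₀ r, ‖lam ^ (1 / (p : ℂ)) / (p * lam)‖ ≤ c ∧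
        η ≤ (lam ^ (1 / (p : ℂ))).re ∧
        ∀ σ : ℂ, 0 < σ.re → σ.re ≤ η → Separated p d lam σ := by
  obtain ⟨r, hr, hball⟩ := Metric.nhds_basis_closedBall.mem_iff.1
    ((isOpen_unstableSector hp1).mem_nhds h)
  set K := Metric.closedBall lam₀ r with hK
  have hKc : IsCompact K := isCompact_closedBall _ _
  have hKne : K.Nonempty := ⟨lam₀, Metric.mem_closedBall_self hr.le⟩
  have hpc : (p : ℂ) ≠ 0 := by exact_mod_cast hp0.ne'
  have hroot : ContinuousOn (fun lam : ℂ => lam ^ (1 / (p : ℂ))) K := fun lam hl =>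
    (continuousAt_cpow_const (unstableSector_subset_slitPlane hp1 (hball hl))).continuousWithinAt
  obtain ⟨l1, hl1, hmin⟩ := hKc.exists_isMinOn hKne (Complex.continuous_re.comp_continuousOn hroot)
  have hpos : 0 < (l1 ^ (1 / (p : ℂ))).re := root_re_pos (hball hl1) hp0
  obtain ⟨c, hc⟩ := hKc.exists_bound_of_continuousOn (f := fun lam => lam ^ (1 / (p : ℂ)) / (p * lam))
    (hroot.div (by fun_prop) fun lam hl => mul_ne_zero hpc (hball hl).1)
  obtain ⟨M, hM⟩ := hKc.exists_bound_of_continuousOn (f := fun lam : ℂ => lam) continuousOn_id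
  have hM0 : 0 ≤ M := (norm_nonneg _).trans (hM _ hl1)
  -- Half the least real part of the roots, so that every root lies at distance at least `η` from
  -- the strip.
  set η := (l1 ^ (1 / (p : ℂ))).re / 2 with hη
  have hη0 : 0 < η := by positivity
  have hre : ∀ lam ∈ K, 2 * η ≤ (lam ^ (1 / (p : ℂ))).re := by
    intro lam hl
    have := hmin hl
    simp only [Function.comp, mem_ofPred_eq] at this
    linarith
  set ρ : ℝ := (2 * M + 1) ^ (1 / p) with hρ
  have hρ1 : 1 ≤ ρ := Real.one_le_rpow (by linarith) (by positivity)
  have hρp : ρ ^ p = 2 * M + 1 := by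
    rw [hρ, ← Real.rpow_mul (by linarith), one_div_mul_cancel hp0.ne', Real.rpow_one]
  -- The imaginary axis and `0` are included for compactness; `σ^p` is continuous up to `0` as `0 <
  -- p`, and the roots stay outside. Large `σ` are left to `separated_of_large`.
  set Q : Set (ℂ × ℂ) := (Metric.closedBall 0 ρ ∩ {σ | 0 ≤ σ.re ∧ σ.re ≤ η}) ×ˢ K with hQ
  have hQc : IsCompact Q := by
    refine IsCompact.prod ((isCompact_closedBall _ _).inter_right ?_) hKc
    exact (isClosed_le continuous_const Complex.continuous_re).inter
      (isClosed_le Complex.continuous_re continuous_const)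
  have hQne : Q.Nonempty := ⟨(0, l1), by
    refine ⟨⟨?_, ?_⟩, hl1⟩
    · simp; linarith
    · simp [hη0.le]⟩
  have hQcont : ContinuousOn (fun x : ℂ × ℂ => ‖x.1 ^ (p : ℂ) - x.2‖) Q := by
    intro x hx
    refine ContinuousAt.continuousWithinAt ?_
    have h1 : ContinuousAt (fun z : ℂ => z ^ (p : ℂ)) x.1 :=
      Complex.continuousAt_cpow_const_of_re_pos (Or.inl hx.1.2.1) (by simpa using hp0)
    exact ((ContinuousAt.comp (f := Prod.fst) h1 continuousAt_fst).sub continuousAt_snd).norm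
  obtain ⟨x, hx, hxmin⟩ := hQc.exists_isMinOn hQne hQcont
  set d1 := ‖x.1 ^ (p : ℂ) - x.2‖ with hd1
  have hd10 : 0 < d1 := by
    rw [hd1, norm_pos_iff]
    intro h0
    have h2 := eq_root_of_cpow_eq hp0 hp1 (sub_eq_zero.1 h0)
    have h3 := hre x.2 hx.2
    rw [← h2] at h3
    have h4 : x.1.re ≤ η := hx.1.2.2
    linarith
  set d := min (1 / 2) (min (d1 / ρ ^ p) (η / ρ)) with hd
  have hρp1 : 1 ≤ ρ ^ p := by rw [hρp]; linarith
  have hd0 : 0 < d := by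
    refine lt_min (by norm_num) (lt_min ?_ ?_) <;> positivity
  have hdA : d ≤ 1 / 2 := min_le_left _ _
  have hdB : d * ρ ^ p ≤ d1 := by
    rw [← le_div_iff₀ (by positivity)]
    exact (min_le_right _ _).trans (min_le_left _ _)
  have hdC : d * ρ ≤ η := by
    rw [← le_div_iff₀ (by positivity)]
    exact (min_le_right _ _).trans (min_le_right _ _)
  refine ⟨r, hr, d, hd0, η, hη0, c, hball, fun lam hl => ⟨hc lam hl, ?_, fun σ h0 h1 => ?_⟩⟩
  · linarith [hre lam hl]
  rcases le_total ρ ‖σ‖ with hσ | hσ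
  · refine (separated_of_large hp0 hp1 (hball hl) hρ1 ?_ hσ).anti hdA
    rw [hρp]
    linarith [hM lam hl]
  · have hS : ‖σ ^ (p : ℂ)‖ ≤ ρ ^ p := by
      rw [Complex.norm_cpow_real]; exact Real.rpow_le_rpow (norm_nonneg _) hσ hp0.le
    have e1 : d1 ≤ ‖σ ^ (p : ℂ) - lam‖ := by
      have : (σ, lam) ∈ Q := ⟨⟨by simpa using hσ, h0.le, h1⟩, hl⟩
      exact hxmin this
    have e2 : η ≤ ‖σ - lam ^ (1 / (p : ℂ))‖ := by
      have := Complex.re_le_norm (lam ^ (1 / (p : ℂ)) - σ)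
      rw [Complex.sub_re, norm_sub_rev] at this
      linarith [hre lam hl]
    refine ⟨fun h2 => ?_, ?_, ?_, ?_, ?_⟩
    · rw [h2] at h0; simp at h0
    · nlinarith
    · calc d * ‖σ ^ (p : ℂ)‖ ≤ d * ρ ^ p := by gcongr
        _ ≤ _ := hdB.trans e1
    · nlinarith
    · calc d * ‖σ‖ ≤ d * ρ := by gcongr
        _ ≤ _ := hdC.trans e2

end Separation

/-! ### Decay of the remainder kernel by moving the line of integration. -/

section Lines

variable {p d : ℝ} {lam : ℂ}

lemma line_ne_zero {x : ℝ} (hx : 0 < x) (y : ℝ) : (x : ℂ) + y * Complex.I ≠ 0 := by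
  intro h
  have := congrArg Complex.re h
  simp at this
  exact hx.ne' this

lemma continuous_resolventDeriv2_line {x : ℝ} (hx : 0 < x) (hd : 0 < d)
    (hsep : ∀ y : ℝ, Separated p d lam (x + y * Complex.I)) :
    Continuous fun y : ℝ => resolventDeriv2 p lam (x + y * Complex.I) := by
  have hS : Continuous fun y : ℝ => ((x : ℂ) + y * Complex.I) ^ (p : ℂ) := by
    have := continuous_line_cpow (κ := x) (ω := 0) (by simpa using hx) (p : ℂ)
    simpa using this
  have hne : ∀ y : ℝ, ((x : ℂ) + y * Complex.I) ^ (p : ℂ) - lam ≠ 0 := fun y =>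
    norm_pos_iff.1 (hd.trans_le (hsep y).2.1)
  unfold resolventDeriv2
  refine Continuous.div (Continuous.add ?_ ?_) (by fun_prop) fun y =>
    pow_ne_zero _ (line_ne_zero hx y)
  · exact Continuous.div (by fun_prop) (by fun_prop) fun y => pow_ne_zero _ (hne y)
  · exact Continuous.div (by fun_prop) (by fun_prop) fun y => pow_ne_zero _ (hne y)

lemma continuous_regularDeriv2_line {x : ℝ} (hx : 0 < x) (hd : 0 < d)
    (hsep : ∀ y : ℝ, Separated p d lam (x + y * Complex.I)) :
    Continuous fun y : ℝ => regularDeriv2 p lam (x + y * Complex.I) := by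
  unfold regularDeriv2
  refine (continuous_resolventDeriv2_line hx hd hsep).sub (continuous_const.mul ?_)
  exact Continuous.inv₀ (by fun_prop) fun y => pow_ne_zero _
    (norm_pos_iff.1 (hd.trans_le (hsep y).2.2.2.1))

lemma continuous_exp_line (x s : ℝ) :
    Continuous fun y : ℝ => Complex.exp (((x : ℂ) + y * Complex.I) * s) := by fun_prop

lemma integrable_exp_mul_line {x s : ℝ} {g : ℝ → ℂ} {C : ℝ} (hp1 : p < 1) (hx : 0 < x)
    (hg : Continuous g) (hle : ∀ y : ℝ, ‖g y‖ ≤ C * ‖(x : ℂ) + y * Complex.I‖ ^ (p - 2)) :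
    Integrable fun y : ℝ => Complex.exp (((x : ℂ) + y * Complex.I) * s) * g y := by
  obtain ⟨K, -, hK⟩ := integrable_norm_line_rpow (a := 2 - p) (by linarith)
  refine Integrable.mono' (((hK x hx).1.const_mul C).const_mul (Real.exp (x * s)))
    ((continuous_exp_line x s).mul hg).aestronglyMeasurable (ae_of_all _ fun y => ?_)
  rw [norm_mul, norm_exp_line, neg_sub]
  gcongr
  exact hle y

/-- The inversion formula for `remKernel` on a line to the right of all singularities. -/
lemma integral_line_regularDeriv2 (hp0 : 0 < p) (hp1 : p < 1) (h : lam ∈ unstableSector p)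
    (hd : 0 < d) {κ : ℝ} (hκ : 0 < κ) (hlam : ‖lam‖ < κ ^ p)
    (hsep : ∀ y : ℝ, Separated p d lam (κ + y * Complex.I)) {s : ℝ} (hs : 0 < s) :
    ∫ y : ℝ, Complex.exp (((κ : ℂ) + y * Complex.I) * s) *
        regularDeriv2 p lam (κ + y * Complex.I) =
      2 * Real.pi * ((s ^ 2 : ℝ) : ℂ) * remKernel p s lam := by
  set ω := lam ^ (1 / (p : ℂ)) with hω
  have hωκ : ω.re < κ := by
    refine (Complex.re_le_norm ω).trans_lt ?_
    refine (Real.rpow_lt_rpow_iff (norm_nonneg _) hκ.le hp0).1 ?_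
    rwa [norm_root_rpow hp0 h]
  have i1 := integrable_exp_mul_line (s := s) hp1 hκ (continuous_resolventDeriv2_line hκ hd hsep)
    (fun y => norm_resolventDeriv2_le hp0 hp1 (hsep y).1 hd (hsep y).2.1 (hsep y).2.2.1)
  have i2 := (integrable_line_cpow (a := 3) (by norm_num) hωκ s).const_mul (2 * (ω / (p * lam)))
  have e : ∀ y : ℝ, Complex.exp (((κ : ℂ) + y * Complex.I) * s) *
        regularDeriv2 p lam (κ + y * Complex.I) =
      Complex.exp (((κ : ℂ) + y * Complex.I) * s) * resolventDeriv2 p lam (κ + y * Complex.I) -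
      2 * (ω / (p * lam)) * (Complex.exp (((κ : ℂ) + y * Complex.I) * s) *
        ((κ : ℂ) + y * Complex.I - ω) ^ (-((3 : ℝ) : ℂ))) := by
    intro y
    have : (-((3 : ℝ) : ℂ)) = -((3 : ℕ) : ℂ) := by norm_num
    rw [regularDeriv2, ← hω, this, Complex.cpow_neg, Complex.cpow_natCast]
    ring
  simp only [e]
  rw [integral_sub i1 i2, integral_const_mul, integral_line_resolventDeriv2 hp0 hκ hlam hs,
    integral_line_cpow (by norm_num) hωκ hs, remKernel, expKernel, ← hω]
  have e1 : s ^ (p + 1) = s ^ 2 * s ^ (p - 1) := by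
    rw [← Real.rpow_natCast, ← Real.rpow_add hs]; congr 1; push_cast; ring
  have e2 : Real.Gamma 3 = 2 := by
    have := Real.Gamma_nat_eq_factorial 2
    norm_num at this ⊢
  have e3 : s ^ ((3 : ℝ) - 1) = s ^ 2 := by rw [← Real.rpow_natCast]; norm_num
  rw [e1, e2, e3]
  push_cast
  ring

/-- The remainder kernel decays like `s ^ (-1 - p)`, locally uniformly in the eigenvalue. -/
lemma exists_norm_remKernel_le (hp0 : 0 < p) (hp1 : p < 1) {lam₀ : ℂ}
    (h : lam₀ ∈ unstableSector p) :
    ∃ r > 0, ∃ η > 0, ∃ c C : ℝ, Metric.closedBall lam₀ r ⊆ unstableSector p ∧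
      ∀ lam ∈ Metric.closedBall lam₀ r, ‖lam ^ (1 / (p : ℂ)) / (p * lam)‖ ≤ c ∧
        η ≤ (lam ^ (1 / (p : ℂ))).re ∧
        ∀ s : ℝ, 1 / η ≤ s → ‖remKernel p s lam‖ ≤ C * s ^ (-1 - p) := by
  obtain ⟨r, hr, d, hd, η, hη, c, hball, hsep⟩ := exists_separated_strip hp0 hp1 h
  obtain ⟨K, hK0, hK⟩ := integrable_norm_line_rpow (a := 2 - p) (by linarith)
  refine ⟨r, hr, η, hη, c, Real.exp 1 * ((1 / d ^ 2 + 2 / d ^ 3 + 2 * c / d ^ 3) * K), hball,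
    fun lam hl => ⟨(hsep lam hl).1, (hsep lam hl).2.1, fun s hs => ?_⟩⟩
  have hs0 : 0 < s := (one_div_pos.2 hη).trans_le hs
  -- On this line `|exp(σ s)| = e`, and the integral of `|σ|^(p-2)` is of order `ε^(p-1) = s^2
  -- s^(-1-p)`; the `s^2` cancels against the one produced by the two derivatives.
  set ε := 1 / s with hε
  have hε0 : 0 < ε := one_div_pos.2 hs0
  have hεη : ε ≤ η := by
    rw [hε, one_div_le hs0 hη]; exact hs
  obtain ⟨hc, -, hstrip⟩ := hsep lam hl
  have hlU := hball hl
  set ρ : ℝ := (2 * ‖lam‖ + 1) ^ (1 / p) with hρ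
  have hρ1 : 1 ≤ ρ := Real.one_le_rpow (by linarith [norm_nonneg lam]) (by positivity)
  have hρp : ρ ^ p = 2 * ‖lam‖ + 1 := by
    rw [hρ, ← Real.rpow_mul (by positivity), one_div_mul_cancel hp0.ne', Real.rpow_one]
  have hlarge : ∀ σ : ℂ, ρ ≤ ‖σ‖ → Separated p (1 / 2) lam σ := fun σ hσ =>
    separated_of_large hp0 hp1 hlU hρ1 (by rw [hρp]; linarith) hσ
  -- Far enough right for the inversion formula, and with `ε ≤ η ≤ κ` so that the line can be moved
  -- left to `ε`.
  set κ := ρ + η with hκ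
  have hκ0 : 0 < κ := by positivity
  have hκp : ‖lam‖ < κ ^ p := by
    have : ρ ^ p ≤ κ ^ p := Real.rpow_le_rpow (by linarith) (by linarith) hp0.le
    linarith [norm_nonneg lam]
  have sepε : ∀ y : ℝ, Separated p d lam (ε + y * Complex.I) := fun y =>
    hstrip _ (by simpa using hε0) (by simpa using hεη)
  have sepκ : ∀ y : ℝ, Separated p (1 / 2) lam (κ + y * Complex.I) := fun y => hlarge _ (by
    have := Complex.re_le_norm ((κ : ℂ) + y * Complex.I)
    simp at this
    linarith)
  obtain ⟨W, hWd, hW⟩ := exists_regular_extension hp0 hp1 hlU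
  have hWeq : ∀ (d' : ℝ), 0 < d' → ∀ σ : ℂ, 0 < σ.re → Separated p d' lam σ →
      W σ = regularDeriv2 p lam σ := fun d' hd' σ h0 hs =>
    hW σ h0 (sub_ne_zero.1 (norm_pos_iff.1 (hd'.trans_le hs.2.2.2.1)))
  have hWε : ∀ y : ℝ, W (ε + y * Complex.I) = regularDeriv2 p lam (ε + y * Complex.I) := fun y =>
    hWeq d hd _ (by simpa using hε0) (sepε y)
  have hWκ : ∀ y : ℝ, W (κ + y * Complex.I) = regularDeriv2 p lam (κ + y * Complex.I) := fun y =>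
    hWeq _ (by norm_num) _ (by simpa using hκ0) (sepκ y)
  have hbd : ∀ (d' : ℝ), 0 < d' → ∀ σ : ℂ, Separated p d' lam σ →
      ‖regularDeriv2 p lam σ‖ ≤ (1 / d' ^ 2 + 2 / d' ^ 3 + 2 * c / d' ^ 3) * ‖σ‖ ^ (p - 2) := by
    intro d' hd' σ hs
    refine (norm_regularDeriv2_le hp0 hp1 hs.1 hd' hs.2.1 hs.2.2.1 hs.2.2.2.1 hs.2.2.2.2).trans ?_
    gcongr
  have hc0 : 0 ≤ c := (norm_nonneg _).trans hc
  have intε := integrable_exp_mul_line (s := s) hp1 hε0 (continuous_regularDeriv2_line hε0 hd sepε)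
    (fun y => hbd d hd _ (sepε y))
  have intκ := integrable_exp_mul_line (s := s) hp1 hκ0
    (continuous_regularDeriv2_line hκ0 (by norm_num) sepκ)
    (fun y => hbd (1 / 2) (by norm_num) _ (sepκ y))
  have hshift := integral_line_eq_of_decay (f := fun σ => Complex.exp (σ * s) * W σ)
    (ε := ε) (κ := κ) (C := Real.exp (κ * s) * (1 / (1 / 2) ^ 2 + 2 / (1 / 2) ^ 3 +
      2 * c / (1 / 2) ^ 3)) (a := 2 - p) (Y := ρ)
    (DifferentiableOn.mul (by fun_prop) hWd) hε0 (by linarith)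
    (by simpa only [hWε] using intε) (by simpa only [hWκ] using intκ) (by linarith)
    (by
      intro x y hx1 hx2 hy
      have hx0 : 0 < x := hε0.trans_le hx1
      have him : |y| ≤ ‖(x : ℂ) + y * Complex.I‖ := by
        have := Complex.abs_im_le_norm ((x : ℂ) + y * Complex.I)
        simpa using this
      have hsp := hlarge _ (hy.trans him)
      rw [norm_mul, norm_exp_line, hWeq _ (by norm_num) _ (by simpa using hx0) hsp, mul_assoc]
      gcongr
      refine (hbd _ (by norm_num) _ hsp).trans ?_
      gcongr ?_ * ?_
      rw [neg_sub]
      exact Real.rpow_le_rpow_of_nonpos (by linarith) him (by linarith))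
  simp only [hWε, hWκ] at hshift
  rw [integral_line_regularDeriv2 hp0 hp1 hlU (by norm_num) hκ0 hκp sepκ hs0] at hshift
  have hle : ‖∫ y : ℝ, Complex.exp (((ε : ℂ) + y * Complex.I) * s) *
      regularDeriv2 p lam (ε + y * Complex.I)‖ ≤
      Real.exp 1 * ((1 / d ^ 2 + 2 / d ^ 3 + 2 * c / d ^ 3) * (K * ε ^ (1 - (2 - p)))) := by
    rw [← (hK ε hε0).2, ← integral_const_mul, ← integral_const_mul]
    refine norm_integral_le_of_norm_le (((hK ε hε0).1.const_mul _).const_mul _)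
      (ae_of_all _ fun y => ?_)
    rw [norm_mul, norm_exp_line, neg_sub]
    have : ε * s = 1 := by rw [hε]; field_simp
    rw [this]
    gcongr
    exact hbd d hd _ (sepε y)
  rw [hshift, norm_mul, norm_mul, norm_mul, Complex.norm_two, Complex.norm_real, Complex.norm_real,
    Real.norm_of_nonneg Real.pi_pos.le, Real.norm_of_nonneg (sq_nonneg s)] at hle
  have hεs : ε ^ (1 - (2 - p)) = s ^ 2 * s ^ (-1 - p) := by
    rw [hε, one_div, Real.inv_rpow hs0.le, ← Real.rpow_neg hs0.le, ← Real.rpow_natCast,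
      ← Real.rpow_add hs0]
    congr 1; push_cast; ring
  rw [hεs] at hle
  have hs2 : 0 < s ^ 2 := by positivity
  have hpi : 1 ≤ 2 * Real.pi := by linarith [Real.pi_gt_three]
  refine le_of_mul_le_mul_left ?_ hs2
  calc s ^ 2 * ‖remKernel p s lam‖ ≤ 2 * Real.pi * s ^ 2 * ‖remKernel p s lam‖ := by
        gcongr
        nlinarith
    _ ≤ _ := hle
    _ = _ := by ring

end Lines

/-! ### Termwise differentiation of entire power series. -/

section PowerSeries

/-- The sum of a power series. -/
noncomputable def powSum (a : ℕ → ℂ) (z : ℂ) : ℂ := ∑' k : ℕ, a k * z ^ k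

variable {a : ℕ → ℂ}

lemma hasSum_powSum (ha : ∀ r : ℝ, Summable fun k : ℕ => ‖a k‖ * r ^ k) (z : ℂ) :
    HasSum (fun k : ℕ => a k * z ^ k) (powSum a z) := by
  refine Summable.hasSum (Summable.of_norm ?_)
  simpa using ha ‖z‖

lemma differentiable_powSum (ha : ∀ r : ℝ, Summable fun k : ℕ => ‖a k‖ * r ^ k) :
    Differentiable ℂ (powSum a) := by
  intro z
  have h := Complex.differentiableOn_tsum_of_summable_norm (ha (‖z‖ + 1))
    (F := fun k w => a k * w ^ k) (U := Metric.ball 0 (‖z‖ + 1)) (fun k => by fun_prop)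
    Metric.isOpen_ball (fun k w hw => by
      rw [norm_mul, norm_pow]
      have : ‖w‖ < ‖z‖ + 1 := by simpa using hw
      gcongr)
  exact h.differentiableAt (Metric.isOpen_ball.mem_nhds (by simp))

/-- Power series may be differentiated termwise any number of times. -/
lemma hasSum_iteratedDeriv_powSum (ha : ∀ r : ℝ, Summable fun k : ℕ => ‖a k‖ * r ^ k) (m : ℕ) :
    ∀ z : ℂ, HasSum (fun k : ℕ => iteratedDeriv m (fun w => a k * w ^ k) z)
      (iteratedDeriv m (powSum a) z) := by
  induction m with
  | zero => intro z; simpa using hasSum_powSum ha z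
  | succ m ih =>
    intro z
    have hd : ∀ k, Differentiable ℂ (iteratedDeriv m fun w : ℂ => a k * w ^ k) := fun k =>
      (ContDiff.differentiable_iteratedDeriv m (n := ⊤) (by fun_prop) (by exact_mod_cast WithTop.coe_lt_top _))
    have h := Complex.hasSum_deriv_of_summable_norm (z := z)
      ((ha (‖z‖ + 1 + 1)).mul_left (m.factorial : ℝ))
      (F := fun k => iteratedDeriv m fun w : ℂ => a k * w ^ k) (U := Metric.ball 0 (‖z‖ + 1))
      (fun k => (hd k).differentiableOn) Metric.isOpen_ball (fun k w hw => by
        have hw' : ‖w‖ < ‖z‖ + 1 := by simpa using hw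
        -- Cauchy's estimate on the unit circle about `w`, which lies in the disc of radius `‖z‖ +
        -- 2`.
        have := Complex.norm_iteratedDeriv_le_of_forall_mem_sphere_norm_le (c := w) (R := 1)
          (C := ‖a k‖ * (‖z‖ + 1 + 1) ^ k) (f := fun w : ℂ => a k * w ^ k) m one_pos
          (Differentiable.diffContOnCl (by fun_prop)) (fun v hv => by
            rw [norm_mul, norm_pow]
            have h1 : ‖v - w‖ = 1 := by simpa [dist_eq_norm] using hv
            have h2 : ‖v‖ ≤ ‖v - w‖ + ‖w‖ := by simpa using norm_add_le (v - w) w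
            gcongr
            linarith)
        simpa using this) (by simp)
    have e : (fun w => ∑' k, iteratedDeriv m (fun w : ℂ => a k * w ^ k) w) =
        iteratedDeriv m (powSum a) := by
      ext w; exact (ih w).tsum_eq
    rw [e] at h
    simpa only [iteratedDeriv_succ] using h

end PowerSeries

/-! ### Derivative of the Mittag-Leffler function and its exponential part. -/

section ScalarML

variable {p β : ℝ}

lemma summable_scaled (hp : 0 < p) (x : ℂ) (r : ℝ) : Summable fun k : ℕ =>
    ‖(((Real.Gamma (p * k + β))⁻¹ : ℝ) : ℂ) * x ^ k‖ * r ^ k := by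
  have := summable_scalarML (β := β) hp (‖x‖ * r)
  refine this.congr fun k => ?_
  rw [norm_mul, norm_pow, mul_pow]; ring

lemma scalarML_mul_eq_powSum (x z : ℂ) : scalarML p β (x * z) =
    powSum (fun k : ℕ => (((Real.Gamma (p * k + β))⁻¹ : ℝ) : ℂ) * x ^ k) z := by
  unfold scalarML powSum
  congr 1; ext k; rw [mul_pow]; ring

lemma scalarML_eq_powSum : scalarML p β =
    powSum (fun k : ℕ => (((Real.Gamma (p * k + β))⁻¹ : ℝ) : ℂ)) := rfl

lemma differentiable_scalarML (hp : 0 < p) : Differentiable ℂ (scalarML p β) := by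
  rw [scalarML_eq_powSum]
  exact differentiable_powSum (fun r => summable_scalarML hp r)

/-- Differentiate termwise; the functional equation of `Γ` cancels the factor `k + 1`. It makes `s ↦
E_p(s^p lam)` a primitive of `lam s^(p-1) E_{p,p}(s^p lam)` for `s > 0`. -/
lemma hasDerivAt_scalarML_one (hp : 0 < p) (z : ℂ) :
    HasDerivAt (scalarML p 1) (1 / p * scalarML p p z) z := by
  have hd := (differentiable_scalarML (β := 1) hp z).hasDerivAt
  have h1 := hasSum_iteratedDeriv_powSum (a := fun k : ℕ => (((Real.Gamma (p * k + 1))⁻¹ : ℝ) : ℂ))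
    (fun r => summable_scalarML (β := 1) hp r) 1 z
  rw [← scalarML_eq_powSum] at h1
  simp only [iteratedDeriv_one] at h1
  have h2 := (hasSum_nat_add_iff' 1).2 h1
  have h3 := (hasSum_scalarML (β := p) hp z).mul_left (1 / (p : ℂ))
  have : deriv (scalarML p 1) z = 1 / p * scalarML p p z := by
    rw [← sub_zero (deriv _ _)]
    refine Eq.trans ?_ (h2.unique ?_)
    · simp
    convert! h3 using 1
    · ext k
      have hk : 0 < p * ((k : ℝ) + 1) := by positivity
      have e : Real.Gamma (p * ((k + 1 : ℕ) : ℝ) + 1) =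
          p * (k + 1) * Real.Gamma (p * k + p) := by
        push_cast
        rw [Real.Gamma_add_one hk.ne']; congr 2; ring
      have hG : Real.Gamma (p * k + p) ≠ 0 := (Real.Gamma_pos_of_pos (by positivity)).ne'
      have hk' : (k : ℂ) + 1 ≠ 0 := by exact_mod_cast Nat.succ_ne_zero k
      have hpc : (p : ℂ) ≠ 0 := by exact_mod_cast hp.ne'
      have hGc : (Real.Gamma (p * k + p) : ℂ) ≠ 0 := by exact_mod_cast hG
      rw [e]
      rw [deriv_const_mul_field, deriv_pow_field]
      push_cast
      field_simp
  rw [← this]; exact hd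

/-- The Mittag-Leffler function minus its exponential part, as an integral of the remainder. -/
lemma scalarML_one_sub_exp (hp0 : 0 < p) {lam : ℂ} (h : lam ∈ unstableSector p) {t : ℝ}
    (ht : 0 < t) (hint : IntervalIntegrable (fun s => remKernel p s lam) volume 0 t) :
    scalarML p 1 (((t ^ p : ℝ) : ℂ) * lam) -
      1 / (p : ℂ) * Complex.exp (t * lam ^ (1 / (p : ℂ))) =
    1 - 1 / p + lam * ∫ s in (0 : ℝ)..t, remKernel p s lam := by
  set ω := lam ^ (1 / (p : ℂ)) with hω
  have hpc : (p : ℂ) ≠ 0 := by exact_mod_cast hp0.ne'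
  set f : ℝ → ℂ := fun s => scalarML p 1 (((s ^ p : ℝ) : ℂ) * lam) -
      1 / (p : ℂ) * Complex.exp (s * ω) with hf
  have hcont : Continuous f := by
    have h1 : Continuous fun s : ℝ => s ^ p := Real.continuous_rpow_const hp0.le
    have h2 := (differentiable_scalarML (β := 1) hp0).continuous
    simp only [hf]
    fun_prop
  -- Only the open interval is possible, `s^(p-1)` being singular at `0`; continuity on `[0, t]` and
  -- integrability suffice for the fundamental theorem.
  have hder : ∀ s ∈ Ioo 0 t, HasDerivAt f (lam * remKernel p s lam) s := by
    intro s hs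
    have hs0 : s ≠ 0 := hs.1.ne'
    have e1 : HasDerivAt (fun s : ℝ => ((s ^ p : ℝ) : ℂ) * lam)
        (((p * s ^ (p - 1) : ℝ) : ℂ) * lam) s :=
      ((Real.hasDerivAt_rpow_const (Or.inl hs0)).ofReal_comp).mul_const lam
    have e2 := (hasDerivAt_scalarML_one hp0 (((s ^ p : ℝ) : ℂ) * lam)).comp s e1
    have e3 : HasDerivAt (fun s : ℝ => (s : ℂ) * ω) (1 * ω) s :=
      ((hasDerivAt_id s).ofReal_comp).mul_const ω
    have e4 := (e3.cexp).const_mul (1 / (p : ℂ))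
    convert! e2.sub e4 using 1
    rw [remKernel, expKernel, ← hω]
    have := h.1
    push_cast
    field_simp
  have hFTC := intervalIntegral.integral_eq_sub_of_hasDerivAt_of_le ht.le hcont.continuousOn hder
    (hint.const_mul lam)
  rw [intervalIntegral.integral_const_mul] at hFTC
  have h0 : f 0 = 1 - 1 / p := by
    simp only [hf]
    rw [Real.zero_rpow hp0.ne']
    have : scalarML p 1 0 = 1 := by
      rw [scalarML, tsum_eq_single 0 (fun k hk => by simp [hk])]
      simp
    simp [this]
  rw [hFTC, h0]
  simp only [hf]
  ring

end ScalarML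

/-! ### Integrable majorants, uniform for eigenvalues in a disc. -/

section Bounds

variable {p : ℝ}

lemma measurable_remKernel (hp0 : 0 < p) (lam : ℂ) : Measurable fun s => remKernel p s lam := by
  have h2 := (differentiable_scalarML (β := p) hp0).continuous.measurable
  unfold remKernel expKernel
  fun_prop

/-- Locally uniform bounds for the scalar kernels. -/
lemma exists_kernel_bounds (hp0 : 0 < p) (hp1 : p < 1) {lam₀ : ℂ}
    (h : lam₀ ∈ unstableSector p) :
    ∃ r > 0, ∃ M M' : ℝ → ℝ, ∃ D : ℝ, Metric.closedBall lam₀ r ⊆ unstableSector p ∧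
      IntegrableOn M (Ioi 0) ∧ IntegrableOn M' (Ioi 0) ∧
      ∀ lam ∈ Metric.closedBall lam₀ r,
        (∀ s : ℝ, 0 ≤ s → ‖remKernel p s lam‖ ≤ M s) ∧
        (∀ s : ℝ, 0 ≤ s → ‖expKernel p (-s) lam‖ ≤ M' s) ∧
        ∀ t : ℝ, 0 < t → ‖scalarML p 1 (((t ^ p : ℝ) : ℂ) * lam) -
          1 / (p : ℂ) * Complex.exp (t * lam ^ (1 / (p : ℂ)))‖ ≤ D := by
  obtain ⟨r, hr, η, hη, c, C, hball, hK⟩ := exists_norm_remKernel_le hp0 hp1 h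
  set K := Metric.closedBall lam₀ r with hKdef
  have hKc : IsCompact K := isCompact_closedBall _ _
  set s₀ := 1 / η with hs₀
  have hs₀0 : 0 < s₀ := one_div_pos.2 hη
  have hc0 : 0 ≤ c := (norm_nonneg _).trans (hK lam₀ (Metric.mem_closedBall_self hr.le)).1
  have hQcont : ContinuousOn (fun x : ℝ × ℂ => scalarML p p (((x.1 ^ p : ℝ) : ℂ) * x.2))
      (Icc 0 s₀ ×ˢ K) := by
    have h1 : Continuous fun s : ℝ => s ^ p := Real.continuous_rpow_const hp0.le
    have h2 := (differentiable_scalarML (β := p) hp0).continuous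
    exact Continuous.continuousOn (by fun_prop)
  obtain ⟨A, hA⟩ := (isCompact_Icc.prod hKc).exists_bound_of_continuousOn hQcont
  have hroot : ContinuousOn (fun x : ℝ × ℂ => expKernel p x.1 x.2) (Icc 0 s₀ ×ˢ K) := by
    have hr' : ContinuousOn (fun x : ℝ × ℂ => x.2 ^ (1 / (p : ℂ))) (Icc 0 s₀ ×ˢ K) := by
      intro x hx
      refine ContinuousAt.continuousWithinAt ?_
      exact ContinuousAt.comp (f := Prod.snd)
        (continuousAt_cpow_const (unstableSector_subset_slitPlane hp1 (hball hx.2))) continuousAt_snd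
    have hpc : (p : ℂ) ≠ 0 := by exact_mod_cast hp0.ne'
    unfold expKernel
    refine ContinuousOn.mul (hr'.div (by fun_prop) fun x hx => mul_ne_zero hpc (hball hx.2).1) ?_
    exact ((Complex.continuous_ofReal.comp continuous_fst).continuousOn.mul hr').cexp
  obtain ⟨B, hB⟩ := (isCompact_Icc.prod hKc).exists_bound_of_continuousOn hroot
  obtain ⟨L, hL⟩ := hKc.exists_bound_of_continuousOn (f := fun lam : ℂ => lam) continuousOn_id
  -- Integrable at `0` because `0 < p`, and at infinity because `-1 - p < -1`.
  set M : ℝ → ℝ := fun s => if s ≤ s₀ then s ^ (p - 1) * A + B else C * s ^ (-1 - p) with hM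
  have hrem : ∀ lam ∈ K, ∀ s : ℝ, 0 ≤ s → ‖remKernel p s lam‖ ≤ M s := by
    intro lam hl s hs
    simp only [hM]
    split_ifs with hss
    · have hx : (s, lam) ∈ Icc 0 s₀ ×ˢ K := ⟨⟨hs, hss⟩, hl⟩
      have hA' : ‖scalarML p p (((s ^ p : ℝ) : ℂ) * lam)‖ ≤ A := hA (s, lam) hx
      have hB' : ‖expKernel p s lam‖ ≤ B := hB (s, lam) hx
      rw [remKernel]
      refine (norm_sub_le _ _).trans (add_le_add ?_ hB')
      rw [norm_mul, Complex.norm_real, Real.norm_of_nonneg (by positivity)]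
      gcongr
    · exact (hK lam hl).2.2 s (not_le.1 hss).le
  have hMint : IntegrableOn M (Ioi 0) := by
    rw [← Ioc_union_Ioi_eq_Ioi hs₀0.le]
    refine IntegrableOn.union ?_ ?_
    · have : IntegrableOn (fun s : ℝ => s ^ (p - 1) * A + B) (Ioc 0 s₀) := by
        rw [← intervalIntegrable_iff_integrableOn_Ioc_of_le hs₀0.le]
        exact ((intervalIntegral.intervalIntegrable_rpow' (by linarith)).mul_const A).add
          intervalIntegrable_const
      refine this.congr_fun (fun s hs => ?_) measurableSet_Ioc
      simp [hM, hs.2]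
    · have : IntegrableOn (fun s : ℝ => C * s ^ (-1 - p)) (Ioi s₀) :=
        (integrableOn_Ioi_rpow_of_lt (by linarith) hs₀0).const_mul C
      refine this.congr_fun (fun s hs => ?_) measurableSet_Ioi
      simp [hM, not_le.2 (show s₀ < s from hs)]
  refine ⟨r, hr, M, fun s => c * Real.exp (-η * s), ‖(1 - 1 / p : ℂ)‖ + L * ∫ s in Ioi 0, M s,
    hball, hMint, (integrableOn_exp_mul_Ioi (by linarith) 0).const_mul c,
    fun lam hl => ⟨hrem lam hl, fun s hs => ?_, fun t ht => ?_⟩⟩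
  · obtain ⟨h1, h2, -⟩ := hK lam hl
    rw [expKernel, norm_mul, Complex.norm_exp]
    refine mul_le_mul h1 (Real.exp_le_exp.2 ?_) (Real.exp_nonneg _) hc0
    rw [Complex.re_ofReal_mul]
    nlinarith
  · have hi : IntegrableOn (fun s => remKernel p s lam) (Ioi 0) := by
      refine Integrable.mono' hMint (measurable_remKernel hp0 lam).aestronglyMeasurable ?_
      exact (ae_restrict_iff' measurableSet_Ioi).2 (ae_of_all _ fun s (hs : 0 < s) =>
        hrem lam hl s hs.le)
    have hii : IntervalIntegrable (fun s => remKernel p s lam) volume 0 t := by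
      rw [intervalIntegrable_iff_integrableOn_Ioc_of_le ht.le]
      exact hi.mono_set Ioc_subset_Ioi_self
    rw [scalarML_one_sub_exp hp0 (hball hl) ht hii]
    refine (norm_add_le _ _).trans ?_
    gcongr
    rw [norm_mul]
    have hL0 : 0 ≤ L := (norm_nonneg _).trans (hL lam hl)
    gcongr
    · exact hL lam hl
    rw [intervalIntegral.integral_of_le ht.le]
    refine (norm_integral_le_integral_norm _).trans ?_
    calc ∫ s in Ioc 0 t, ‖remKernel p s lam‖ ≤ ∫ s in Ioi 0, ‖remKernel p s lam‖ :=
          setIntegral_mono_set hi.norm (ae_of_all _ fun s => norm_nonneg _)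
            (Eventually.of_forall fun s hs => hs.1)
      _ ≤ _ := setIntegral_mono_on hi.norm hMint measurableSet_Ioi fun s (hs : 0 < s) =>
          hrem lam hl s hs.le

end Bounds

/-! ### Functional calculus on a single Jordan block. -/

section Toeplitz

/-- The Taylor coefficients of a function. -/
noncomputable def taylorCoeff (m : ℕ) (F : ℂ → ℂ) (z : ℂ) : ℂ :=
  1 / (m.factorial : ℂ) * iteratedDeriv m F z

/-- The value `F(J)` of a holomorphic function at a Jordan block. -/
noncomputable def toeplitz (m : ℕ) (F : ℂ → ℂ) (z : ℂ) : Matrix (Fin m) (Fin m) ℂ :=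
  upperToeplitz m fun i => taylorCoeff i F z

variable {F G : ℂ → ℂ} {z : ℂ}

lemma taylorCoeff_mul (hF : AnalyticAt ℂ F z) (hG : AnalyticAt ℂ G z) (m : ℕ) :
    taylorCoeff m (fun w => F w * G w) z =
      ∑ i ∈ Finset.range (m + 1), taylorCoeff i F z * taylorCoeff (m - i) G z := by
  rw [taylorCoeff, iteratedDeriv_fun_mul hF.contDiffAt hG.contDiffAt, Finset.mul_sum]
  refine Finset.sum_congr rfl fun i hi => ?_
  have hi' : i ≤ m := Nat.lt_succ_iff.1 (Finset.mem_range.1 hi)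
  rw [taylorCoeff, taylorCoeff, Nat.cast_choose ℂ hi']
  have h1 : (m.factorial : ℂ) ≠ 0 := by exact_mod_cast m.factorial_ne_zero
  have h2 : (i.factorial : ℂ) ≠ 0 := by exact_mod_cast i.factorial_ne_zero
  have h3 : ((m - i).factorial : ℂ) ≠ 0 := by exact_mod_cast (m - i).factorial_ne_zero
  field_simp

lemma upperToeplitz_mul (m : ℕ) (a b : ℕ → ℂ) :
    upperToeplitz m a * upperToeplitz m b =
      upperToeplitz m fun k => ∑ i ∈ Finset.range (k + 1), a i * b (k - i) := by
  ext i k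
  rw [Matrix.mul_apply]
  simp only [upperToeplitz, Matrix.of_apply]
  rw [Fin.sum_univ_eq_sum_range (fun l => (if (i : ℕ) ≤ l then a (l - i) else 0) *
    if l ≤ (k : ℕ) then b (k - l) else 0) m]
  have h1 : ∀ l : ℕ, ((if (i : ℕ) ≤ l then a (l - i) else 0) *
      if l ≤ (k : ℕ) then b (k - l) else 0) =
      if l ∈ Finset.Ico (i : ℕ) (k + 1) then a (l - i) * b (k - l) else 0 := by
    intro l
    simp only [Finset.mem_Ico, Nat.lt_succ_iff]
    split_ifs <;> simp_all
  simp only [h1]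
  rw [← Finset.sum_filter]
  have h2 : (Finset.range m).filter (fun l => l ∈ Finset.Ico (i : ℕ) (k + 1)) =
      Finset.Ico (i : ℕ) (k + 1) := by
    ext l
    simp only [Finset.mem_filter, Finset.mem_range, Finset.mem_Ico]
    have := k.2
    omega
  rw [h2, Finset.sum_Ico_eq_sum_range]
  split_ifs with hik
  · have : (k : ℕ) + 1 - i = k - i + 1 := by omega
    rw [this]
    refine Finset.sum_congr rfl fun l hl => ?_
    rw [Nat.add_sub_cancel_left, Nat.sub_add_eq]
  · have : (k : ℕ) + 1 - i = 0 := by omega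
    rw [this, Finset.sum_range_zero]

lemma toeplitz_mul (m : ℕ) (hF : AnalyticAt ℂ F z) (hG : AnalyticAt ℂ G z) :
    toeplitz m F z * toeplitz m G z = toeplitz m (fun w => F w * G w) z := by
  rw [toeplitz, toeplitz, upperToeplitz_mul, toeplitz]
  simp only [taylorCoeff_mul hF hG]

lemma toeplitz_one (m : ℕ) : toeplitz m (fun _ => 1) z = 1 := by
  ext i k
  simp only [toeplitz, upperToeplitz, Matrix.of_apply, taylorCoeff, iteratedDeriv_const,
    Matrix.one_apply, Fin.ext_iff]
  split_ifs with h1 h2 h3 h4 <;> first | omega | simp_all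

lemma jordanBlock_eq_toeplitz (m : ℕ) : jordanBlock m z = toeplitz m (fun w => w) z := by
  ext i k
  have hid : ∀ n, iteratedDeriv n (fun w : ℂ => w) z = iteratedDeriv n id z := fun n => rfl
  simp only [toeplitz, upperToeplitz, Matrix.of_apply, taylorCoeff, jordanBlock, hid,
    iteratedDeriv_id, Fin.ext_iff]
  by_cases h1 : (i : ℕ) = k
  · simp [h1]
  · by_cases h2 : (i : ℕ) + 1 = k
    · have h3 : (k : ℕ) - i = 1 := by omega
      have h4 : (i : ℕ) ≤ k := by omega
      simp [h1, h2, h3, h4]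
    · by_cases h4 : (i : ℕ) ≤ k
      · have h5 : (k : ℕ) - i ≠ 0 := by omega
        have h6 : (k : ℕ) - i ≠ 1 := by omega
        simp [h1, h2, h4, h5, h6]
      · simp [h1, h2, h4]

lemma jordanBlock_pow (m k : ℕ) : jordanBlock m z ^ k = toeplitz m (fun w => w ^ k) z := by
  induction k with
  | zero => simp [toeplitz_one]
  | succ k ih =>
    rw [pow_succ, ih, jordanBlock_eq_toeplitz, toeplitz_mul m (by fun_prop) (by fun_prop)]
    simp only [pow_succ]

/-- Convergence is entrywise, and each entry is a Taylor coefficient, so this is termwise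
differentiation of the scalar series. -/
lemma hasSum_toeplitz_powSum {a : ℕ → ℂ} (ha : ∀ r : ℝ, Summable fun k : ℕ => ‖a k‖ * r ^ k)
    (m : ℕ) : HasSum (fun k => a k • jordanBlock m z ^ k) (toeplitz m (powSum a) z) := by
  refine Pi.hasSum.2 fun i => Pi.hasSum.2 fun j => ?_
  simp only [jordanBlock_pow, Matrix.smul_apply, toeplitz, upperToeplitz, Matrix.of_apply]
  split_ifs with h
  · have := (hasSum_iteratedDeriv_powSum ha (j - i) z).mul_left
      (1 / (((j : ℕ) - i).factorial : ℂ))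
    rw [← taylorCoeff] at this
    convert! this using 2 with k
    rw [iteratedDeriv_const_mul_field, taylorCoeff, smul_eq_mul]
    ring
  · simp

end Toeplitz

/-! ### Functional calculus on the unstable subspace. -/

namespace JordanForm

variable {n : ℕ} {A : Matrix (Fin n) (Fin n) ℂ} (J : JordanForm A) (p : ℝ)

lemma unstableDiag_mul (D E : ∀ j, Matrix (Fin (J.size j)) (Fin (J.size j)) ℂ) :
    J.unstableDiag p D * J.unstableDiag p E = J.unstableDiag p fun j => D j * E j := by
  classical
  unfold unstableDiag
  rw [show ∀ X Y : Matrix (Σ j : Fin J.l, Fin (J.size j)) (Σ j : Fin J.l, Fin (J.size j)) ℂ,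
    J.P * X * J.Pinv * (J.P * Y * J.Pinv) = J.P * (X * (J.Pinv * J.P) * Y) * J.Pinv by
      intro X Y; simp only [Matrix.mul_assoc], J.Pinv_mul_P, Matrix.mul_one,
    ← Matrix.blockDiagonal'_mul]
  congr 3
  ext1 j
  split_ifs <;> simp

lemma pow_eq (k : ℕ) : A ^ k =
    J.P * Matrix.blockDiagonal' (fun j => jordanBlock (J.size j) (J.eig j) ^ k) * J.Pinv := by
  have h : ∀ k : ℕ, A ^ k = J.P *
      Matrix.blockDiagonal' (fun j => jordanBlock (J.size j) (J.eig j)) ^ k * J.Pinv := by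
    intro k
    induction k with
    | zero => rw [pow_zero, pow_zero, Matrix.mul_one, J.P_mul_Pinv]
    | succ k ih =>
      rw [pow_succ, ih]
      refine (congrArg (_ * ·) J.eq_conj).trans ?_
      rw [show ∀ X Y : Matrix (Σ j : Fin J.l, Fin (J.size j)) (Σ j : Fin J.l, Fin (J.size j)) ℂ,
        J.P * X * J.Pinv * (J.P * Y * J.Pinv) = J.P * (X * (J.Pinv * J.P) * Y) * J.Pinv by
          intro X Y; simp only [Matrix.mul_assoc], J.Pinv_mul_P, Matrix.mul_one, pow_succ]
  rw [h, ← Matrix.blockDiagonal'_pow]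
  rfl

/-- The Mittag-Leffler function of a multiple of `A`, block by block. -/
lemma mittagLeffler_smul {p : ℝ} (hp : 0 < p) (β : ℝ) (x : ℂ) :
    mittagLeffler p β (x • A) = J.P * Matrix.blockDiagonal' (fun j =>
      toeplitz (J.size j) (fun z => scalarML p β (x * z)) (J.eig j)) * J.Pinv := by
  set a : ℕ → ℂ := fun k => (((Real.Gamma (p * k + β))⁻¹ : ℝ) : ℂ) * x ^ k with ha
  have hfun : (fun z => scalarML p β (x * z)) = powSum a := by
    ext z; exact scalarML_mul_eq_powSum x z
  rw [hfun]
  have h1 : HasSum (fun k j => a k • jordanBlock (J.size j) (J.eig j) ^ k)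
      (fun j => toeplitz (J.size j) (powSum a) (J.eig j)) := by
    rw [Pi.hasSum]
    exact fun j => hasSum_toeplitz_powSum (summable_scaled hp x) _
  have h2 := h1.matrix_blockDiagonal'
  have h3 := h2.map (AddMonoidHom.mk' (fun X : Matrix (Σ j : Fin J.l, Fin (J.size j))
      (Σ j : Fin J.l, Fin (J.size j)) ℂ => J.P * X * J.Pinv)
      (fun X Y => by simp only [Matrix.mul_add, Matrix.add_mul]))
    (by
      show Continuous fun X : Matrix (Σ j : Fin J.l, Fin (J.size j))
        (Σ j : Fin J.l, Fin (J.size j)) ℂ => J.P * X * J.Pinv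
      fun_prop)
  rw [mittagLeffler]
  refine HasSum.tsum_eq ?_
  convert! h3 using 1
  ext1 k
  simp only [Function.comp, AddMonoidHom.mk'_apply]
  rw [smul_pow, smul_smul, J.pow_eq k,
    show (fun j => a k • jordanBlock (J.size j) (J.eig j) ^ k) =
      a k • (fun j => jordanBlock (J.size j) (J.eig j) ^ k) from rfl, Matrix.blockDiagonal'_smul,
    Matrix.mul_smul, Matrix.smul_mul]

/-- The holomorphic functional calculus on the unstable part. -/
noncomputable def unstableFun (F : ℂ → ℂ) : Matrix (Fin n) (Fin n) ℂ :=
  J.unstableDiag p fun j => toeplitz (J.size j) F (J.eig j)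

variable {p}

lemma unstableDiag_congr {D E : ∀ j, Matrix (Fin (J.size j)) (Fin (J.size j)) ℂ}
    (h : ∀ j, IsUnstable p (J.eig j) → D j = E j) : J.unstableDiag p D = J.unstableDiag p E := by
  unfold unstableDiag
  congr 3
  ext1 j
  split_ifs with hj
  · rw [h j hj]
  · rfl

/-- Only germs at the unstable eigenvalues matter, so identities valid merely on the sector, off the
branch cut, can be used. -/
lemma unstableFun_congr {F G : ℂ → ℂ}
    (h : ∀ j, IsUnstable p (J.eig j) → F =ᶠ[𝓝 (J.eig j)] G) :
    J.unstableFun p F = J.unstableFun p G := by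
  refine J.unstableDiag_congr fun j hj => ?_
  simp only [toeplitz, taylorCoeff, fun i => (h j hj).iteratedDeriv_eq i]

lemma unstableFun_mul {F G : ℂ → ℂ} (hF : ∀ j, IsUnstable p (J.eig j) → AnalyticAt ℂ F (J.eig j))
    (hG : ∀ j, IsUnstable p (J.eig j) → AnalyticAt ℂ G (J.eig j)) :
    J.unstableFun p F * J.unstableFun p G = J.unstableFun p fun z => F z * G z := by
  rw [unstableFun, unstableFun, unstableDiag_mul]
  exact J.unstableDiag_congr fun j hj => toeplitz_mul _ (hF j hj) (hG j hj)

lemma unstableFun_const_mul (c : ℂ) (F : ℂ → ℂ) :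
    J.unstableFun p (fun z => c * F z) = c • J.unstableFun p F := by
  unfold unstableFun unstableDiag
  rw [← Matrix.smul_mul, ← Matrix.mul_smul, ← Matrix.blockDiagonal'_smul]
  congr 3
  ext1 j
  simp only [Pi.smul_apply]
  split_ifs
  · ext i k
    simp only [toeplitz, upperToeplitz, Matrix.of_apply, Matrix.smul_apply, taylorCoeff,
      iteratedDeriv_const_mul_field]
    split_ifs
    · rw [smul_eq_mul]; ring
    · simp
  · simp

lemma unstableFun_sub {F G : ℂ → ℂ} (hF : ∀ j, IsUnstable p (J.eig j) → AnalyticAt ℂ F (J.eig j))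
    (hG : ∀ j, IsUnstable p (J.eig j) → AnalyticAt ℂ G (J.eig j)) :
    J.unstableFun p (fun z => F z - G z) = J.unstableFun p F - J.unstableFun p G := by
  unfold unstableFun unstableDiag
  rw [← Matrix.sub_mul, ← Matrix.mul_sub, ← Matrix.blockDiagonal'_sub]
  congr 3
  ext1 j
  simp only [Pi.sub_apply]
  split_ifs with hj
  · ext i k
    simp only [toeplitz, upperToeplitz, Matrix.of_apply, Matrix.sub_apply, taylorCoeff]
    split_ifs
    · rw [iteratedDeriv_fun_sub (hF j hj).contDiffAt (hG j hj).contDiffAt]; ring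
    · simp
  · simp

lemma unstableFun_mul_piU (F : ℂ → ℂ) : J.unstableFun p F * J.piU p = J.unstableFun p F := by
  rw [unstableFun, piU, unstableDiag_mul]
  simp

lemma piU_mul_unstableFun (F : ℂ → ℂ) : J.piU p * J.unstableFun p F = J.unstableFun p F := by
  rw [unstableFun, piU, unstableDiag_mul]
  simp

lemma mittagLeffler_mul_piU (hp : 0 < p) (β : ℝ) (x : ℂ) :
    mittagLeffler p β (x • A) * J.piU p = J.unstableFun p fun z => scalarML p β (x * z) := by
  rw [J.mittagLeffler_smul hp, piU, unstableFun, unstableDiag, unstableDiag]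
  rw [show ∀ X Y : Matrix (Σ j : Fin J.l, Fin (J.size j)) (Σ j : Fin J.l, Fin (J.size j)) ℂ,
    J.P * X * J.Pinv * (J.P * Y * J.Pinv) = J.P * (X * (J.Pinv * J.P) * Y) * J.Pinv by
      intro X Y; simp only [Matrix.mul_assoc], J.Pinv_mul_P, Matrix.mul_one,
    ← Matrix.blockDiagonal'_mul]
  congr 3
  ext1 j
  split_ifs <;> simp

lemma B_eq (t : ℝ) : J.B p t =
    J.unstableFun p fun z => 1 / (p : ℂ) * Complex.exp ((t : ℂ) * z ^ (1 / (p : ℂ))) := rfl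

lemma Btilde_eq (t : ℝ) : J.Btilde p t =
    J.unstableFun p (deriv fun z => Complex.exp ((t : ℂ) * z ^ (1 / (p : ℂ)))) := by
  unfold Btilde unstableFun toeplitz taylorCoeff psiTilde
  simp only [iteratedDeriv_succ']

end JordanForm

/-! ### Bounds and measurability of Taylor coefficients. -/

section Coefficients

/-- Cauchy's estimate. It is the reason why the scalar bounds are needed on a whole disc and not
just at the eigenvalue. -/
lemma norm_taylorCoeff_le {F : ℂ → ℂ} {z : ℂ} {r C : ℝ} (hr : 0 < r)
    (hF : DifferentiableOn ℂ F (Metric.closedBall z r))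
    (hC : ∀ w ∈ Metric.closedBall z r, ‖F w‖ ≤ C) (m : ℕ) :
    ‖taylorCoeff m F z‖ ≤ C * (1 / r) ^ m := by
  have h := Complex.norm_iteratedDeriv_le_of_forall_mem_sphere_norm_le m hr
    (hF.mono (closure_minimal Metric.ball_subset_closedBall Metric.isClosed_closedBall)).diffContOnCl
    (fun w hw => hC w (Metric.sphere_subset_closedBall hw))
  have hm : (0 : ℝ) < m.factorial := by exact_mod_cast m.factorial_pos
  rw [taylorCoeff, norm_mul, norm_div, norm_one, Complex.norm_natCast, one_div_mul_eq_div,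
    div_le_iff₀ hm, one_div, inv_pow]
  calc _ ≤ _ := h
    _ = _ := by rw [div_eq_mul_inv]; ring

/-- Derivatives of a holomorphic function depend measurably on parameters. -/
lemma measurable_iteratedDeriv_param {X : Type*} [MeasurableSpace X] {F : X → ℂ → ℂ} {U : Set ℂ}
    (hU : IsOpen U) (hd : ∀ x, DifferentiableOn ℂ (F x) U) (hm : ∀ z ∈ U, Measurable fun x => F x z)
    (m : ℕ) : ∀ z ∈ U, Measurable fun x => iteratedDeriv m (F x) z := by
  induction m with
  | zero => simpa using hm
  | succ m ih =>
    intro z hz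
    have hda : ∀ x, DifferentiableAt ℂ (iteratedDeriv m (F x)) z := fun x =>
      ((((hd x).analyticOnNhd hU).iterated_deriv m z hz).differentiableAt).congr_of_eventuallyEq
        (by rw [iteratedDeriv_eq_iterate])
    have hseq : Tendsto (fun k : ℕ => (1 / ((k : ℂ) + 1))) atTop (𝓝[≠] 0) := by
      refine tendsto_nhdsWithin_of_tendsto_nhds_of_eventually_within _
        tendsto_one_div_add_atTop_nhds_zero_nat (Eventually.of_forall fun k => ?_)
      have : (k : ℂ) + 1 ≠ 0 := by exact_mod_cast Nat.succ_ne_zero k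
      simpa using this
    have hev : ∀ᶠ k : ℕ in atTop, z + 1 / ((k : ℂ) + 1) ∈ U := by
      have h1 : Tendsto (fun k : ℕ => z + 1 / ((k : ℂ) + 1)) atTop (𝓝 (z + 0)) :=
        tendsto_const_nhds.add (hseq.mono_right nhdsWithin_le_nhds)
      rw [add_zero] at h1
      exact h1.eventually (hU.mem_nhds hz)
    obtain ⟨k₀, hk₀⟩ := eventually_atTop.1 hev
    -- The derivative is a limit of difference quotients with increments `1/(k+1)`; the shift by
    -- `k₀` keeps all sample points in `U`.
    refine measurable_of_tendsto_metrizable (f := fun (k : ℕ) x =>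
      (1 / (((k + k₀ : ℕ) : ℂ) + 1))⁻¹ • (iteratedDeriv m (F x) (z + 1 / (((k + k₀ : ℕ) : ℂ) + 1)) -
        iteratedDeriv m (F x) z)) (fun k => ?_) ?_
    · exact ((ih _ (hk₀ _ (Nat.le_add_left _ _))).sub (ih z hz)).const_smul
        (1 / (((k + k₀ : ℕ) : ℂ) + 1))⁻¹
    · rw [tendsto_pi_nhds]
      intro x
      rw [iteratedDeriv_succ]
      exact ((hasDerivAt_iff_tendsto_slope_zero.1 (hda x).hasDerivAt).comp hseq).comp
        (tendsto_add_atTop_nat k₀)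

variable {p : ℝ}

lemma differentiableOn_root (hp1 : p < 1) :
    DifferentiableOn ℂ (fun z : ℂ => z ^ (1 / (p : ℂ))) (unstableSector p) := fun _ hz =>
  (differentiableAt_id.cpow_const
    (unstableSector_subset_slitPlane hp1 hz)).differentiableWithinAt

lemma differentiableOn_expKernel (hp0 : 0 < p) (hp1 : p < 1) (u : ℝ) :
    DifferentiableOn ℂ (expKernel p u) (unstableSector p) := by
  have hr := differentiableOn_root hp1
  have hpc : (p : ℂ) ≠ 0 := by exact_mod_cast hp0.ne'
  unfold expKernel
  exact (hr.div (by fun_prop) fun _ hz => mul_ne_zero hpc hz.1).mul (hr.const_mul _).cexp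

lemma differentiable_scalarML_mul (hp0 : 0 < p) (β : ℝ) (x : ℂ) :
    Differentiable ℂ fun z => scalarML p β (x * z) :=
  (differentiable_scalarML hp0).comp (by fun_prop)

lemma differentiableOn_remKernel (hp0 : 0 < p) (hp1 : p < 1) (s : ℝ) :
    DifferentiableOn ℂ (remKernel p s) (unstableSector p) := by
  unfold remKernel
  exact ((differentiable_scalarML_mul hp0 p _).differentiableOn.const_mul _).sub
    (differentiableOn_expKernel hp0 hp1 s)

/-- `lam ↦ (1 / p) exp (t lam ^ (1 / p))`. -/
noncomputable def expSymbol (p t : ℝ) (lam : ℂ) : ℂ :=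
  1 / (p : ℂ) * Complex.exp ((t : ℂ) * lam ^ (1 / (p : ℂ)))

/-- `lam ↦ E_p (t ^ p lam) - (1 / p) exp (t lam ^ (1 / p))`. -/
noncomputable def remSymbol (p t : ℝ) (lam : ℂ) : ℂ :=
  scalarML p 1 (((t ^ p : ℝ) : ℂ) * lam) - expSymbol p t lam

lemma differentiableOn_expSymbol (hp1 : p < 1) (t : ℝ) :
    DifferentiableOn ℂ (expSymbol p t) (unstableSector p) :=
  ((differentiableOn_root hp1).const_mul _).cexp.const_mul _

lemma differentiableOn_remSymbol (hp0 : 0 < p) (hp1 : p < 1) (t : ℝ) :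
    DifferentiableOn ℂ (remSymbol p t) (unstableSector p) :=
  (differentiable_scalarML_mul hp0 1 _).differentiableOn.sub (differentiableOn_expSymbol hp1 t)

lemma measurable_expKernel (lam : ℂ) : Measurable fun u => expKernel p u lam := by
  unfold expKernel
  fun_prop

/-- Bounds for the Taylor coefficients of the kernels at one eigenvalue. -/
lemma exists_taylorCoeff_bounds (hp0 : 0 < p) (hp1 : p < 1) {lam₀ : ℂ}
    (h : lam₀ ∈ unstableSector p) (N : ℕ) :
    ∃ M M' : ℝ → ℝ, ∃ D : ℝ, (∀ s, 0 ≤ M s) ∧ (∀ s, 0 ≤ M' s) ∧ 0 ≤ D ∧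
      IntegrableOn M (Ioi 0) ∧ IntegrableOn M' (Ioi 0) ∧ ∀ m < N,
        (∀ s : ℝ, 0 ≤ s → ‖taylorCoeff m (remKernel p s) lam₀‖ ≤ M s) ∧
        (∀ s : ℝ, 0 ≤ s → ‖taylorCoeff m (expKernel p (-s)) lam₀‖ ≤ M' s) ∧
        ∀ t : ℝ, 0 < t → ‖taylorCoeff m (remSymbol p t) lam₀‖ ≤ D := by
  obtain ⟨r, hr, M, M', D, hball, hM, hM', hb⟩ := exists_kernel_bounds hp0 hp1 h
  set R : ℝ := ∑ m ∈ Finset.range N, (1 / r) ^ m with hR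
  have hR0 : 0 ≤ R := Finset.sum_nonneg fun m _ => by positivity
  have hRm : ∀ m < N, (1 / r) ^ m ≤ R := fun m hm =>
    Finset.single_le_sum (f := fun m => (1 / r) ^ m) (fun m _ => by positivity)
      (Finset.mem_range.2 hm)
  have key : ∀ (F : ℂ → ℂ) (C : ℝ), DifferentiableOn ℂ F (unstableSector p) →
      (∀ w ∈ Metric.closedBall lam₀ r, ‖F w‖ ≤ C) → ∀ m < N, ‖taylorCoeff m F lam₀‖ ≤ |C| * R := by
    intro F C hF hC m hm
    refine (norm_taylorCoeff_le hr (hF.mono hball) hC m).trans ?_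
    exact mul_le_mul (le_abs_self C) (hRm m hm) (by positivity) (abs_nonneg C)
  refine ⟨fun s => |M s| * R, fun s => |M' s| * R, |D| * R, fun s => by positivity,
    fun s => by positivity, by positivity, hM.abs.mul_const R, hM'.abs.mul_const R,
    fun m hm => ⟨fun s hs => ?_, fun s hs => ?_, fun t ht => ?_⟩⟩
  · exact key _ _ (differentiableOn_remKernel hp0 hp1 s) (fun w hw => (hb w hw).1 s hs) m hm
  · exact key _ _ (differentiableOn_expKernel hp0 hp1 _) (fun w hw => (hb w hw).2.1 s hs) m hm
  · exact key _ _ (differentiableOn_remSymbol hp0 hp1 t) (fun w hw => (hb w hw).2.2 t ht) m hm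

end Coefficients

/-! ### From scalar coefficients to operators. -/

namespace JordanForm

variable {n : ℕ} {A : Matrix (Fin n) (Fin n) ℂ} (J : JordanForm A) {p : ℝ}

lemma IsHyperbolic.mem_unstableSector {J : JordanForm A} (hJ : J.IsHyperbolic p) {j : Fin J.l}
    (hj : IsUnstable p (J.eig j)) : J.eig j ∈ unstableSector p := ⟨(hJ j).1, hj⟩

/-- Bounds for the Taylor coefficients of the kernels at all unstable eigenvalues. -/
lemma exists_taylorCoeff_bounds (hJ : J.IsHyperbolic p) (hp0 : 0 < p) (hp1 : p < 1) :
    ∃ M M' : ℝ → ℝ, ∃ D : ℝ, (∀ s, 0 ≤ M s) ∧ (∀ s, 0 ≤ M' s) ∧ 0 ≤ D ∧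
      IntegrableOn M (Ioi 0) ∧ IntegrableOn M' (Ioi 0) ∧
      ∀ j, IsUnstable p (J.eig j) → ∀ m < J.size j,
        (∀ s : ℝ, 0 ≤ s → ‖taylorCoeff m (remKernel p s) (J.eig j)‖ ≤ M s) ∧
        (∀ s : ℝ, 0 ≤ s → ‖taylorCoeff m (expKernel p (-s)) (J.eig j)‖ ≤ M' s) ∧
        ∀ t : ℝ, 0 < t → ‖taylorCoeff m (remSymbol p t) (J.eig j)‖ ≤ D := by
  have hex : ∀ j, ∃ M M' : ℝ → ℝ, ∃ D : ℝ, (∀ s, 0 ≤ M s) ∧ (∀ s, 0 ≤ M' s) ∧ 0 ≤ D ∧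
      IntegrableOn M (Ioi 0) ∧ IntegrableOn M' (Ioi 0) ∧
      (IsUnstable p (J.eig j) → ∀ m < J.size j,
        (∀ s : ℝ, 0 ≤ s → ‖taylorCoeff m (remKernel p s) (J.eig j)‖ ≤ M s) ∧
        (∀ s : ℝ, 0 ≤ s → ‖taylorCoeff m (expKernel p (-s)) (J.eig j)‖ ≤ M' s) ∧
        ∀ t : ℝ, 0 < t → ‖taylorCoeff m (remSymbol p t) (J.eig j)‖ ≤ D) := by
    intro j
    by_cases hj : IsUnstable p (J.eig j)
    · obtain ⟨M, M', D, h1, h2, h3, h4, h5, h6⟩ :=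
        FracSys.exists_taylorCoeff_bounds hp0 hp1 (hJ.mem_unstableSector hj) (J.size j)
      exact ⟨M, M', D, h1, h2, h3, h4, h5, fun _ => h6⟩
    · exact ⟨fun _ => 0, fun _ => 0, 0, fun _ => le_rfl, fun _ => le_rfl, le_rfl,
        integrableOn_zero, integrableOn_zero, fun h => absurd h hj⟩
  choose M M' D h1 h2 h3 h4 h5 h6 using hex
  refine ⟨fun s => ∑ j, M j s, fun s => ∑ j, M' j s, ∑ j, D j,
    fun s => Finset.sum_nonneg fun j _ => h1 j s, fun s => Finset.sum_nonneg fun j _ => h2 j s,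
    Finset.sum_nonneg fun j _ => h3 j, integrable_finsetSum _ fun j _ => h4 j,
    integrable_finsetSum _ fun j _ => h5 j, fun j hj m hm => ⟨fun s hs => ?_, fun s hs => ?_,
      fun t ht => ?_⟩⟩
  · exact ((h6 j hj m hm).1 s hs).trans
      (Finset.single_le_sum (f := fun j => M j s) (fun j _ => h1 j s) (Finset.mem_univ j))
  · exact ((h6 j hj m hm).2.1 s hs).trans
      (Finset.single_le_sum (f := fun j => M' j s) (fun j _ => h2 j s) (Finset.mem_univ j))
  · exact ((h6 j hj m hm).2.2 t ht).trans
      (Finset.single_le_sum (f := fun j => D j) (fun j _ => h3 j) (Finset.mem_univ j))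

variable (p) in
/-- The operator of the functional calculus on the unstable part. -/
noncomputable def act (F : ℂ → ℂ) : EuclideanSpace ℂ (Fin n) →L[ℂ] EuclideanSpace ℂ (Fin n) :=
  LinearMap.toContinuousLinearMap (Matrix.toEuclideanLin (J.unstableFun p F))

lemma act_apply (F : ℂ → ℂ) (v : EuclideanSpace ℂ (Fin n)) :
    J.act p F v = Matrix.toEuclideanLin (J.unstableFun p F) v := rfl

open Classical in
variable (p) in
/-- The coefficients of `unstableFun`: Taylor coefficients at the unstable eigenvalues. -/
noncomputable def coeff (F : ℂ → ℂ) (x : Σ j : Fin J.l, Fin (J.size j)) : ℂ :=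
  if IsUnstable p (J.eig x.1) then taylorCoeff x.2 F (J.eig x.1) else 0

/-- The elementary Toeplitz matrix in one block. -/
noncomputable def basisDiag (x : Σ j : Fin J.l, Fin (J.size j)) :
    ∀ j, Matrix (Fin (J.size j)) (Fin (J.size j)) ℂ :=
  Pi.single x.1 (upperToeplitz (J.size x.1) (Pi.single (x.2 : ℕ) 1))

/-- The operators of which the functional calculus is a linear combination. -/
noncomputable def basisOp (x : Σ j : Fin J.l, Fin (J.size j)) :
    EuclideanSpace ℂ (Fin n) →L[ℂ] EuclideanSpace ℂ (Fin n) :=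
  LinearMap.toContinuousLinearMap (Matrix.toEuclideanLin (J.P *
    Matrix.blockDiagonal' (J.basisDiag x) * J.Pinv))

lemma _root_.FracSys.upperToeplitz_eq_sum (m : ℕ) (c : ℕ → ℂ) :
    upperToeplitz m c = ∑ i : Fin m, c i • upperToeplitz m (Pi.single (i : ℕ) 1) := by
  ext a b
  rw [Matrix.sum_apply]
  simp only [upperToeplitz, Matrix.of_apply, Matrix.smul_apply]
  split_ifs with h
  · rw [Finset.sum_eq_single (⟨b - a, by omega⟩ : Fin m)]
    · simp
    · intro i _ hi
      have : (b : ℕ) - a ≠ i := fun h => hi (Fin.ext h.symm)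
      simp [this]
    · simp
  · simp

/-- The operators `basisOp` do not depend on `F`, so norm bounds and measurability of `act` follow
from those of finitely many scalars. -/
lemma act_eq_sum (F : ℂ → ℂ) : J.act p F = ∑ x, J.coeff p F x • J.basisOp x := by
  classical
  have h1 : (fun j => if IsUnstable p (J.eig j) then toeplitz (J.size j) F (J.eig j) else 0) =
      ∑ x : Σ j : Fin J.l, Fin (J.size j), J.coeff p F x •
        J.basisDiag x := by
    ext1 j
    rw [Finset.sum_apply, Fintype.sum_sigma, Finset.sum_eq_single j]
    · simp only [Pi.smul_apply, basisDiag, Pi.single_eq_same, coeff]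
      split_ifs
      · exact upperToeplitz_eq_sum _ _
      · simp
    · intro j' _ hj
      refine Finset.sum_eq_zero fun m _ => ?_
      rw [Pi.smul_apply, basisDiag, Pi.single_eq_of_ne hj.symm, smul_zero]
    · simp
  have h2 : J.unstableFun p F = ∑ x, J.coeff p F x • (J.P *
      Matrix.blockDiagonal' (J.basisDiag x) * J.Pinv) := by
    have h3 := congrArg (Matrix.blockDiagonal'AddMonoidHom (fun j => Fin (J.size j))
      (fun j => Fin (J.size j)) ℂ) h1
    rw [map_sum] at h3
    simp only [Matrix.blockDiagonal'AddMonoidHom_apply, Matrix.blockDiagonal'_smul] at h3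
    rw [unstableFun, unstableDiag]
    rw [show (Matrix.blockDiagonal' fun j => if IsUnstable p (J.eig j) then
      toeplitz (J.size j) F (J.eig j) else 0) = _ from h3, Matrix.mul_sum, Matrix.sum_mul]
    simp only [Matrix.mul_smul, Matrix.smul_mul]
  rw [act, h2, map_sum, map_sum]
  simp only [map_smul, basisOp]

lemma exists_norm_act_le : ∃ c : ℝ, 0 ≤ c ∧ ∀ (F : ℂ → ℂ) (b : ℝ), 0 ≤ b →
    (∀ j, IsUnstable p (J.eig j) → ∀ m < J.size j, ‖taylorCoeff m F (J.eig j)‖ ≤ b) →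
    ∀ v, ‖J.act p F v‖ ≤ c * b * ‖v‖ := by
  refine ⟨∑ x, ‖J.basisOp x‖, Finset.sum_nonneg fun x _ => norm_nonneg _, fun F b hb h v => ?_⟩
  have : ‖J.act p F‖ ≤ (∑ x, ‖J.basisOp x‖) * b := by
    rw [act_eq_sum, Finset.sum_mul]
    refine norm_sum_le_of_le _ fun x _ => ?_
    rw [norm_smul, mul_comm]
    gcongr
    rw [coeff]
    split_ifs with hx
    · exact h x.1 hx x.2 x.2.2
    · simpa using hb
  exact (J.act p F).le_of_opNorm_le this v

lemma measurable_act (hJ : J.IsHyperbolic p) (hp1 : p < 1) {F : ℝ → ℂ → ℂ}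
    (hd : ∀ τ, DifferentiableOn ℂ (F τ) (unstableSector p))
    (hm : ∀ z, Measurable fun τ => F τ z) {g : ℝ → EuclideanSpace ℂ (Fin n)} (hg : Measurable g) :
    Measurable fun τ => J.act p (F τ) (g τ) := by
  simp only [act_eq_sum, sum_apply, smul_apply]
  refine Finset.measurable_fun_sum _ fun x _ => ?_
  refine Measurable.smul (f := fun τ => J.coeff p (F τ) x) (g := fun τ => J.basisOp x (g τ)) ?_ ((J.basisOp x).continuous.measurable.comp hg)
  unfold coeff
  split_ifs with hx
  · exact (measurable_iteratedDeriv_param (isOpen_unstableSector hp1) hd (fun z _ => hm z) _ _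
      (hJ.mem_unstableSector hx)).const_mul _
  · exact measurable_const

end JordanForm

/-! ### The three integrands in terms of the kernels. -/

section Integrands

variable {n : ℕ} {A : Matrix (Fin n) (Fin n) ℂ} {J : JordanForm A} {p : ℝ}

lemma analyticAt_of_unstable (hJ : J.IsHyperbolic p) (hp1 : p < 1) {F : ℂ → ℂ}
    (hF : DifferentiableOn ℂ F (unstableSector p)) :
    ∀ j, IsUnstable p (J.eig j) → AnalyticAt ℂ F (J.eig j) := fun _ hj =>
  hF.analyticAt ((isOpen_unstableSector hp1).mem_nhds (hJ.mem_unstableSector hj))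

/-- Differentiating `exp(-τ z^(1/p))` produces a factor `-τ`, which removes the apparent singularity
of `p/τ` at `0`. -/
lemma smul_Btilde_eq (hJ : J.IsHyperbolic p) (hp0 : 0 < p) (hp1 : p < 1) {τ : ℝ} (hτ : 0 < τ) :
    ((p / τ : ℝ) : ℂ) • J.Btilde p (-τ) = (-p : ℂ) • J.unstableFun p (expKernel p (-τ)) := by
  rw [J.Btilde_eq, ← J.unstableFun_const_mul, ← J.unstableFun_const_mul]
  refine J.unstableFun_congr fun j hj => ?_
  filter_upwards [(isOpen_unstableSector hp1).mem_nhds (hJ.mem_unstableSector hj)] with z hz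
  have hpc : (p : ℂ) ≠ 0 := by exact_mod_cast hp0.ne'
  have hτc : (τ : ℂ) ≠ 0 := by exact_mod_cast hτ.ne'
  have h1 := ((hasDerivAt_id' z).cpow_const (c := 1 / (p : ℂ))
    (unstableSector_subset_slitPlane hp1 hz)).const_mul (((-τ : ℝ) : ℂ))
  rw [h1.cexp.deriv, Complex.cpow_sub _ _ hz.1, Complex.cpow_one, expKernel]
  have hz0 := hz.1
  push_cast
  field_simp

lemma act_mul (hJ : J.IsHyperbolic p) (hp1 : p < 1) {F G : ℂ → ℂ}
    (hF : DifferentiableOn ℂ F (unstableSector p)) (hG : DifferentiableOn ℂ G (unstableSector p))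
    (v : EuclideanSpace ℂ (Fin n)) :
    J.act p F (J.act p G v) = J.act p (fun z => F z * G z) v := by
  simp only [J.act_apply]
  rw [← J.unstableFun_mul (analyticAt_of_unstable hJ hp1 hF) (analyticAt_of_unstable hJ hp1 hG),
    Matrix.toLpLin_mul_same]
  rfl

/-- `C` also acts on the stable blocks, but the second factor vanishes there. -/
lemma C_mul_unstableFun (hJ : J.IsHyperbolic p) (hp0 : 0 < p) (hp1 : p < 1) (t : ℝ) (G : ℂ → ℂ) :
    J.C p t * J.unstableFun p G = J.unstableFun p (remSymbol p t) * J.unstableFun p G := by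
  have h : J.unstableFun p (remSymbol p t) = J.C p t * J.piU p := by
    rw [JordanForm.C, sub_mul, J.mittagLeffler_mul_piU hp0, J.B_eq, J.unstableFun_mul_piU]
    exact J.unstableFun_sub
      (fun _ _ => (differentiable_scalarML_mul hp0 1 _).analyticAt _)
      (analyticAt_of_unstable hJ hp1 (differentiableOn_expSymbol hp1 t))
  rw [h, mul_assoc, J.piU_mul_unstableFun]

lemma integrandC_eq (hJ : J.IsHyperbolic p) (hp0 : 0 < p) (hp1 : p < 1) (t : ℝ) {τ : ℝ}
    (hτ : 0 < τ) (v : EuclideanSpace ℂ (Fin n)) : integrandC J p t τ v =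
      (-p : ℂ) • J.act p (remSymbol p t) (J.act p (expKernel p (-τ)) v) := by
  have h : ((p / τ : ℝ) : ℂ) • (J.C p t * J.Btilde p (-τ) * J.piU p) =
      (-p : ℂ) • (J.unstableFun p (remSymbol p t) * J.unstableFun p (expKernel p (-τ))) := by
    rw [← Matrix.smul_mul, ← Matrix.mul_smul, smul_Btilde_eq hJ hp0 hp1 hτ, Matrix.mul_smul,
      Matrix.smul_mul, mul_assoc, J.unstableFun_mul_piU, C_mul_unstableFun hJ hp0 hp1]
  rw [integrandC, ← Complex.coe_smul, ← LinearMap.smul_apply, ← map_smul, h, map_smul,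
    Matrix.toLpLin_mul_same]
  rfl

lemma integrandB_eq (hJ : J.IsHyperbolic p) (hp0 : 0 < p) (hp1 : p < 1) (t : ℝ) {τ : ℝ}
    (hτ : 0 < τ) (v : EuclideanSpace ℂ (Fin n)) : integrandB J p t τ v =
      (-p : ℂ) • J.act p (expSymbol p t) (J.act p (expKernel p (-τ)) v) := by
  have h : ((p / τ : ℝ) : ℂ) • (J.B p t * J.Btilde p (-τ) * J.piU p) =
      (-p : ℂ) • (J.unstableFun p (expSymbol p t) * J.unstableFun p (expKernel p (-τ))) := by
    rw [← Matrix.smul_mul, ← Matrix.mul_smul, smul_Btilde_eq hJ hp0 hp1 hτ, Matrix.mul_smul,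
      Matrix.smul_mul, mul_assoc, J.unstableFun_mul_piU, J.B_eq]
    rfl
  rw [integrandB, ← Complex.coe_smul, ← LinearMap.smul_apply, ← map_smul, h, map_smul,
    Matrix.toLpLin_mul_same]
  rfl

/-- The exponentials at `t` and `-τ` multiply to the one at `t - τ`, and `1/p` cancels the factor
`-p`. For `τ > t` this is exponentially decaying. -/
lemma integrandB_eq_neg (hJ : J.IsHyperbolic p) (hp0 : 0 < p) (hp1 : p < 1) (t : ℝ) {τ : ℝ}
    (hτ : 0 < τ) (v : EuclideanSpace ℂ (Fin n)) : integrandB J p t τ v =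
      -J.act p (expKernel p (t - τ)) v := by
  have hpc : (p : ℂ) ≠ 0 := by exact_mod_cast hp0.ne'
  have h : (fun z => expSymbol p t z * expKernel p (-τ) z) =
      fun z => 1 / (p : ℂ) * expKernel p (t - τ) z := by
    ext z
    have : Complex.exp (((t - τ : ℝ) : ℂ) * z ^ (1 / (p : ℂ))) =
        Complex.exp ((t : ℂ) * z ^ (1 / (p : ℂ))) *
          Complex.exp (((-τ : ℝ) : ℂ) * z ^ (1 / (p : ℂ))) := by
      rw [← Complex.exp_add]; congr 1; push_cast; ring
    rw [expSymbol, expKernel, expKernel, this]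
    ring
  rw [integrandB_eq hJ hp0 hp1 t hτ, act_mul hJ hp1 (differentiableOn_expSymbol hp1 t)
    (differentiableOn_expKernel hp0 hp1 _), h, J.act_apply, J.unstableFun_const_mul, map_smul,
    LinearMap.smul_apply, smul_smul, J.act_apply]
  rw [neg_mul, mul_one_div_cancel hpc, neg_one_smul]

lemma integrandE_eq (hJ : J.IsHyperbolic p) (hp0 : 0 < p) (hp1 : p < 1) (t τ : ℝ)
    (v : EuclideanSpace ℂ (Fin n)) : integrandE J p t τ v =
      J.act p (remKernel p (t - τ)) v + J.act p (expKernel p (t - τ)) v := by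
  have h : J.unstableFun p (remKernel p (t - τ)) =
      (((t - τ) ^ (p - 1) : ℝ) : ℂ) •
        (mittagLeffler p p ((((t - τ) ^ p : ℝ) : ℂ) • A) * J.piU p) -
      J.unstableFun p (expKernel p (t - τ)) := by
    rw [J.mittagLeffler_mul_piU hp0, ← J.unstableFun_const_mul]
    exact J.unstableFun_sub
      (fun _ _ => ((differentiable_scalarML_mul hp0 p _).const_mul _).analyticAt _)
      (analyticAt_of_unstable hJ hp1 (differentiableOn_expKernel hp0 hp1 _))
  rw [integrandE, J.act_apply, h, map_sub, map_smul, J.act_apply, LinearMap.sub_apply,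
    LinearMap.smul_apply, sub_add_cancel]
  exact (Complex.coe_smul _ _).symm

end Integrands

end FracSys

/-! ### The two estimates. -/

open FracSys MeasureTheory Set Filter Topology

theorem lemma8 (p : ℝ) (hp0 : 0 < p) (hp1 : p < 1) (n : ℕ) (A : Matrix (Fin n) (Fin n) ℂ)
    (J : FracSys.JordanForm A) (hJ : J.IsHyperbolic p) (N : ℝ) (hN : 0 < N) :
    ∃ K₃ K₅ : ℝ, ∀ t : ℝ, N < t →
      ∀ g : BoundedContinuousFunction NNReal (EuclideanSpace ℂ (Fin n)),
        (MeasureTheory.IntegrableOn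
            (fun τ : ℝ => FracSys.integrandC J p t τ (g τ.toNNReal)) (Set.Ioi 0) ∧
          ‖∫ τ in Set.Ioi (0 : ℝ), FracSys.integrandC J p t τ (g τ.toNNReal)‖ ≤ K₃ * ‖g‖) ∧
        (IntervalIntegrable
            (fun τ : ℝ => FracSys.integrandE J p t τ (g τ.toNNReal)) MeasureTheory.volume 0 t ∧
          MeasureTheory.IntegrableOn
            (fun τ : ℝ => FracSys.integrandB J p t τ (g τ.toNNReal)) (Set.Ioi 0) ∧
          ‖(∫ τ in (0 : ℝ)..t, FracSys.integrandE J p t τ (g τ.toNNReal)) +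
              ∫ τ in Set.Ioi (0 : ℝ), FracSys.integrandB J p t τ (g τ.toNNReal)‖ ≤ K₅ * ‖g‖ ∧
          (g ≠ 0 →
            ‖(∫ τ in (0 : ℝ)..t, FracSys.integrandE J p t τ (g τ.toNNReal)) +
              ∫ τ in Set.Ioi (0 : ℝ), FracSys.integrandB J p t τ (g τ.toNNReal)‖ < K₅ * ‖g‖)) := by
  obtain ⟨M, M', D, hM0, hM'0, hD0, hM, hM', hb⟩ := J.exists_taylorCoeff_bounds hJ hp0 hp1
  obtain ⟨c, hc0, hc⟩ := J.exists_norm_act_le (p := p)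
  have hrem : ∀ s, 0 ≤ s → ∀ v, ‖J.act p (remKernel p s) v‖ ≤ c * M s * ‖v‖ := fun s hs =>
    hc _ _ (hM0 s) fun j hj m hm => (hb j hj m hm).1 s hs
  have hexp : ∀ s, 0 ≤ s → ∀ v, ‖J.act p (expKernel p (-s)) v‖ ≤ c * M' s * ‖v‖ := fun s hs =>
    hc _ _ (hM'0 s) fun j hj m hm => (hb j hj m hm).2.1 s hs
  have hsym : ∀ s, 0 < s → ∀ v, ‖J.act p (remSymbol p s) v‖ ≤ c * D * ‖v‖ := fun s hs =>
    hc _ _ hD0 fun j hj m hm => (hb j hj m hm).2.2 s hs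
  -- The summand `1` in the second constant serves only the strict inequality.
  refine ⟨p * (c * D * (c * ∫ s in Ioi 0, M' s)),
    c * (∫ s in Ioi 0, M s) + c * (∫ s in Ioi 0, M' s) + 1, fun t ht g => ?_⟩
  have ht0 : 0 < t := hN.trans ht
  set γ : ℝ → EuclideanSpace ℂ (Fin n) := fun τ => g τ.toNNReal with hγ
  have hγm : Measurable γ := (g.continuous.comp continuous_real_toNNReal).measurable
  have hγb : ∀ τ, ‖γ τ‖ ≤ ‖g‖ := fun τ => g.norm_coe_le_norm _
  set X : ℝ → EuclideanSpace ℂ (Fin n) := fun τ => J.act p (expKernel p (-τ)) (γ τ) with hX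
  have hXm : Measurable X := J.measurable_act hJ hp1
    (fun τ => differentiableOn_expKernel hp0 hp1 (-τ))
    (fun z => (measurable_expKernel z).comp measurable_neg) hγm
  have hXb : ∀ τ, 0 < τ → ‖X τ‖ ≤ c * M' τ * ‖g‖ := fun τ hτ =>
    (hexp τ hτ.le (γ τ)).trans
      (mul_le_mul_of_nonneg_left (hγb τ) (mul_nonneg hc0 (hM'0 τ)))
  have hXi : IntegrableOn X (Ioi 0) := by
    refine Integrable.mono' ((hM'.const_mul c).mul_const ‖g‖) hXm.aestronglyMeasurable ?_
    exact (ae_restrict_iff' measurableSet_Ioi).2 (ae_of_all _ hXb)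
  have hpn : ‖(-p : ℂ)‖ = p := by
    rw [norm_neg, Complex.norm_real, Real.norm_of_nonneg hp0.le]
  have hBi : IntegrableOn (fun τ => integrandB J p t τ (γ τ)) (Ioi 0) := by
    refine IntegrableOn.congr_fun (f := fun τ => (-p : ℂ) • J.act p (expSymbol p t) (X τ)) ?_
      (fun τ hτ => (integrandB_eq hJ hp0 hp1 t hτ (γ τ)).symm) measurableSet_Ioi
    exact Integrable.smul (-p : ℂ) (ContinuousLinearMap.integrable_comp _ hXi)
  have hhead : IntegrableOn (fun τ => J.act p (remKernel p (t - τ)) (γ τ)) (Ioc 0 t) ∧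
      ‖∫ τ in Ioc 0 t, J.act p (remKernel p (t - τ)) (γ τ)‖ ≤
        c * (∫ s in Ioi 0, M s) * ‖g‖ := by
    have hMi : IntervalIntegrable M volume 0 t := by
      rw [intervalIntegrable_iff_integrableOn_Ioc_of_le ht0.le]
      exact hM.mono_set Ioc_subset_Ioi_self
    have hMt : IntegrableOn (fun τ => M (t - τ)) (Ioc 0 t) := by
      rw [← intervalIntegrable_iff_integrableOn_Ioc_of_le ht0.le]
      simpa using (hMi.comp_sub_left t).symm
    have hle : ∀ τ ∈ Ioc 0 t, ‖J.act p (remKernel p (t - τ)) (γ τ)‖ ≤ c * M (t - τ) * ‖g‖ :=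
      fun τ hτ => (hrem _ (sub_nonneg.2 hτ.2) (γ τ)).trans
        (mul_le_mul_of_nonneg_left (hγb τ) (mul_nonneg hc0 (hM0 _)))
    have hle' := (ae_restrict_iff' (μ := volume) measurableSet_Ioc).2 (ae_of_all _ hle)
    have hm : Measurable fun τ => J.act p (remKernel p (t - τ)) (γ τ) := J.measurable_act hJ hp1
      (fun τ => differentiableOn_remKernel hp0 hp1 (t - τ))
      (fun z => (measurable_remKernel hp0 z).comp (measurable_const.sub measurable_id)) hγm
    have hdom := (hMt.const_mul c).mul_const ‖g‖
    refine ⟨Integrable.mono' hdom hm.aestronglyMeasurable hle', ?_⟩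
    refine (norm_integral_le_of_norm_le hdom hle').trans ?_
    rw [integral_mul_const, integral_const_mul]
    gcongr
    rw [← intervalIntegral.integral_of_le ht0.le, intervalIntegral.integral_comp_sub_left, sub_self,
      sub_zero, intervalIntegral.integral_of_le ht0.le]
    exact setIntegral_mono_set hM (ae_of_all _ hM0) (Eventually.of_forall fun s hs => hs.1)
  -- Adding `integrandB` on `(0, t]` removes the growing exponential and leaves the integrable
  -- remainder kernel.
  have hEeq : ∀ τ ∈ Ioc 0 t, J.act p (remKernel p (t - τ)) (γ τ) - integrandB J p t τ (γ τ) =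
      integrandE J p t τ (γ τ) := by
    intro τ hτ
    rw [integrandE_eq hJ hp0 hp1, integrandB_eq_neg hJ hp0 hp1 t hτ.1, sub_neg_eq_add]
  have hBc : IntegrableOn (fun τ => integrandB J p t τ (γ τ)) (Ioc 0 t) :=
    hBi.mono_set Ioc_subset_Ioi_self
  have htail : ‖∫ τ in Ioi t, integrandB J p t τ (γ τ)‖ ≤ c * (∫ s in Ioi 0, M' s) * ‖g‖ := by
    have hpre : (fun τ => τ - t) ⁻¹' Ioi 0 = Ioi t := by simp
    have hmp := measurePreserving_sub_right (volume : Measure ℝ) t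
    have hemb := measurableEmbedding_subRight (G := ℝ) t
    have hMt : IntegrableOn (fun τ => M' (τ - t)) (Ioi t) := by
      rw [← hpre]
      exact (hmp.integrableOn_comp_preimage hemb).2 hM'
    have hle : ∀ τ ∈ Ioi t, ‖integrandB J p t τ (γ τ)‖ ≤ c * M' (τ - t) * ‖g‖ := by
      intro τ (hτ : t < τ)
      rw [integrandB_eq_neg hJ hp0 hp1 t (ht0.trans hτ), norm_neg, ← neg_sub τ t]
      exact (hexp _ (sub_nonneg.2 hτ.le) (γ τ)).trans
        (mul_le_mul_of_nonneg_left (hγb τ) (mul_nonneg hc0 (hM'0 _)))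
    refine (norm_integral_le_of_norm_le ((hMt.const_mul c).mul_const ‖g‖)
      ((ae_restrict_iff' measurableSet_Ioi).2 (ae_of_all _ hle))).trans ?_
    rw [integral_mul_const, integral_const_mul]
    have hshift := hmp.setIntegral_preimage_emb hemb M' (Ioi 0)
    rw [hpre] at hshift
    rw [hshift]
  have hmain : ‖(∫ τ in (0 : ℝ)..t, integrandE J p t τ (γ τ)) +
      ∫ τ in Ioi (0 : ℝ), integrandB J p t τ (γ τ)‖ ≤
      (c * (∫ s in Ioi 0, M s) + c * ∫ s in Ioi 0, M' s) * ‖g‖ := by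
    -- Split at `t`: the part over `(0, t]` cancels, leaving the remainder convolution and the tail
    -- over `(t, ∞)`.
    have hsplit := setIntegral_union (Ioc_disjoint_Ioi le_rfl) measurableSet_Ioi hBc
      (hBi.mono_set (Ioi_subset_Ioi ht0.le))
    rw [Ioc_union_Ioi_eq_Ioi ht0.le] at hsplit
    rw [intervalIntegral.integral_of_le ht0.le,
      ← setIntegral_congr_fun measurableSet_Ioc hEeq, integral_sub hhead.1 hBc, hsplit, ← add_assoc,
      sub_add_cancel, add_mul]
    exact (norm_add_le _ _).trans (add_le_add hhead.2 htail)
  refine ⟨⟨?_, ?_⟩, ?_, hBi, ?_, fun hg => ?_⟩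
  · refine IntegrableOn.congr_fun (f := fun τ => (-p : ℂ) • J.act p (remSymbol p t) (X τ)) ?_
      (fun τ hτ => (integrandC_eq hJ hp0 hp1 t hτ (γ τ)).symm) measurableSet_Ioi
    exact Integrable.smul (-p : ℂ) (ContinuousLinearMap.integrable_comp _ hXi)
  · have hle : ∀ τ ∈ Ioi (0 : ℝ), ‖integrandC J p t τ (γ τ)‖ ≤
        p * (c * D * (c * M' τ * ‖g‖)) := by
      intro τ hτ
      rw [integrandC_eq hJ hp0 hp1 t hτ, norm_smul, hpn]
      gcongr
      exact (hsym t ht0 _).trans (by gcongr; exact hXb τ hτ)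
    refine (norm_integral_le_of_norm_le
      (((hM'.const_mul c).mul_const ‖g‖).const_mul (c * D) |>.const_mul p)
      ((ae_restrict_iff' measurableSet_Ioi).2 (ae_of_all _ hle))).trans (le_of_eq ?_)
    rw [integral_const_mul, integral_const_mul, integral_mul_const, integral_const_mul]
    ring
  · rw [intervalIntegrable_iff_integrableOn_Ioc_of_le ht0.le]
    exact (hhead.1.sub hBc).congr_fun hEeq measurableSet_Ioc
  · exact hmain.trans (mul_le_mul_of_nonneg_right (by linarith) (norm_nonneg _))
  · have : 0 < ‖g‖ := norm_pos_iff.2 hg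
    exact hmain.trans_lt (mul_lt_mul_of_pos_right (by linarith) this)
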